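/- Let $\Omega\subset\mathbb R^2$ be a bounded polygonal Lipschitz domain that is subdivided into two disjoint polygonal Lipschitz subdomains $\Omega_{\mathrm S}$ and $\Omega_{\mathrm D}$, that is, $\Omega_{\mathrm S},\Omega_{\mathrm D}\subset\Omega\subset\Omega_{\mathrm S}\cup\Omega_{\mathrm D}\cup\Sigma$ with the interface $\Sigma:=\partial\Omega_{\mathrm S}\cap\partial\Omega_{\mathrm D}$. Put $\Gamma_{\mathrm S}:=\partial\Omega_{\mathrm S}\setminus\Sigma$, and let $\boldsymbol\nu$ be the unit normal on $\Sigma$ pointing from $\Omega_{\mathrm S}$ to $\Omega_{\mathrm D}$. Let $\{\mathcal T^h_{\mathrm S}\}_h$ be a shape-regular family (indexed by an arbitrary discretization label $h$) of conforming triangulations of $\overline\Omega_{\mathrm S}$, each of which induces a partition $\Sigma^h_{\mathrm S}$ of $\Sigma$: $\Sigma$ is the union of the edges of $\mathcal T^h_{\mathrm S}$ contained in it. For each $h$ let $\mathbf H^h(\Omega_{\mathrm S})$ be a linear subspace of $H^1(\Omega_{\mathrm S})^2$ (for instance a finite-dimensional space of piecewise polynomial fields) that contains all continuous vector fields on $\overline\Omega_{\mathrm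 S}$ which are affine on each triangle of $\mathcal T^h_{\mathrm S}$. Assume that (a) either $\Sigma$ is a polygonal line (open or closed) with two or more edges, consecutive edges not being collinear, (b) or $\Sigma$ is a nondegenerate line segment and there is $\delta>0$ such that, for every $h$, some node $\mathbf p_h$ of the partition $\Sigma^h_{\mathrm S}$ satisfies $\operatorname{dist}(\mathbf p_h,\partial\Omega)\ge\delta$ (for instance, $\mathbf p_h=\mathbf p\notin\partial\Omega$ is a fixed node common to all the partitions). Then there exist constants $\beta_0,\beta_1>0$ such that for every $h$ there is $\mathbf v_h\in\mathbf H^h(\Omega_{\mathrm S})$ with $\mathbf v_h=\mathbf 0$ on $\Gamma_{\mathrm S}$ (in the sense of traces), $$\int_\Sigma \mathbf v_h\cdot\boldsymbol\nu\ \ge\ \beta_0\qquad\text{and}\qquad \|\mathbf v_h\|_{H^1(\Omega_{\mathrm S})^2}\le\beta_1 .$$ -/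

import Mathlib

open MeasureTheory Filter Set
open scoped Topology ContDiff NNReal ENNReal RealInnerProductSpace

noncomputable section

/-- The Euclidean plane. -/
abbrev Plane : Type := EuclideanSpace ℝ (Fin 2)

/-- Arc length (one-dimensional Hausdorff measure) in the plane. -/
abbrev arcLength : Measure Plane := Measure.hausdorffMeasure 1

/-! ### Polygonal Lipschitz domains -/

/-- A bounded Lipschitz domain of the plane: a nonempty connected bounded open set that, near each
boundary point and in suitable orthonormal coordinates, is the region strictly above the graph of
a Lipschitz function. -/
structure IsLipschitzDomain (O : Set Plane) : Prop where
  isOpen : IsOpen O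
  isConnected : IsConnected O
  isBounded : Bornology.IsBounded O
  lipschitz : ∀ x ∈ frontier O, ∃ (b : OrthonormalBasis (Fin 2) ℝ Plane) (γ : ℝ → ℝ) (L : ℝ≥0),
    LipschitzWith L γ ∧ ∀ᶠ y in 𝓝 x, (y ∈ O ↔ γ ⟪b 0, y⟫ < ⟪b 1, y⟫)

/-- A bounded Lipschitz domain whose boundary is a finite union of line segments. -/
structure IsPolygonalLipschitzDomain (O : Set Plane) : Prop extends IsLipschitzDomain O where
  polygonal : ∃ F : Finset (Plane × Plane), frontier O = ⋃ e ∈ F, segment ℝ e.1 e.2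

/-- `n` is the unit outward normal of `O` at the flat boundary point `x`: near `x`, the set `O`
is the open half plane with outward normal `n`. -/
def IsOutwardNormal (O : Set Plane) (x n : Plane) : Prop :=
  ‖n‖ = 1 ∧ ∀ᶠ y in 𝓝 x, (y ∈ O ↔ ⟪y - x, n⟫ < 0)

open Classical in
/-- The unit outward normal field of a polygonal domain. It is set to `0` at the points where no
normal exists; on the boundary of a polygonal domain these are the finitely many corners. -/
def outwardNormal (O : Set Plane) (x : Plane) : Plane :=
  if h : ∃ n, IsOutwardNormal O x n then h.choose else 0

/-- The geometric layout: `Ω` is subdivided into the Stokes domain `ΩS` and the Darcy domain `ΩD`.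
The interface between them is `frontier ΩS ∩ frontier ΩD`. -/
structure IsStokesDarcyLayout (Ω ΩS ΩD : Set Plane) : Prop where
  domain : IsPolygonalLipschitzDomain Ω
  stokes : IsPolygonalLipschitzDomain ΩS
  darcy : IsPolygonalLipschitzDomain ΩD
  stokes_subset : ΩS ⊆ Ω
  darcy_subset : ΩD ⊆ Ω
  disjoint : Disjoint ΩS ΩD
  cover : Ω ⊆ ΩS ∪ ΩD ∪ (frontier ΩS ∩ frontier ΩD)

/-- The interface `Σ` between the two subdomains. -/
def interface (ΩS ΩD : Set Plane) : Set Plane := frontier ΩS ∩ frontier ΩD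

/-- `S` is a polygonal line (open or closed) with `n ≥ 2` edges `[P i, P (i + 1)]`. Consecutive
edges are not collinear, so that they are genuinely different edges. -/
def IsPolygonWithTwoOrMoreEdges (S : Set Plane) : Prop :=
  ∃ (n : ℕ) (P : ℕ → Plane), 2 ≤ n ∧
    (∀ i, i + 2 ≤ n → ¬ Collinear ℝ {P i, P (i + 1), P (i + 2)}) ∧
    S = ⋃ i ∈ Finset.range n, segment ℝ (P i) (P (i + 1))

/-- `S` is a nondegenerate line segment. -/
def IsLineSegment (S : Set Plane) : Prop :=
  ∃ A B : Plane, A ≠ B ∧ S = segment ℝ A B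

/-! ### The Sobolev space `H¹` and traces -/

/-- `g` is the weak gradient of `u` in the open set `O`. -/
def IsWeakGradient (O : Set Plane) (u : Plane → ℝ) (g : Plane → Plane) : Prop :=
  ∀ φ : Plane → ℝ, ContDiff ℝ ∞ φ → HasCompactSupport φ → tsupport φ ⊆ O →
    ∀ j : Fin 2, ∫ x in O, u x * fderiv ℝ φ x (EuclideanSpace.single j 1) =
      - ∫ x in O, g x j * φ x

lemma memLp_two_fderiv_test {μ : Measure Plane} [IsFiniteMeasureOnCompacts μ] {φ : Plane → ℝ}
    (h1 : ContDiff ℝ ∞ φ) (h2 : HasCompactSupport φ) (v : Plane) :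
    MemLp (fun x => fderiv ℝ φ x v) 2 μ :=
  ((h1.continuous_fderiv (by simp)).clm_apply continuous_const).memLp_of_hasCompactSupport
    (h2.fderiv_apply (𝕜 := ℝ) v)

lemma memLp_two_test {μ : Measure Plane} [IsFiniteMeasureOnCompacts μ] {φ : Plane → ℝ}
    (h1 : ContDiff ℝ ∞ φ) (h2 : HasCompactSupport φ) : MemLp φ 2 μ :=
  h1.continuous.memLp_of_hasCompactSupport h2

lemma memLp_two_coord {μ : Measure Plane} {g : Plane → Plane} (hg : MemLp g 2 μ) (j : Fin 2) :
    MemLp (fun x => g x j) 2 μ :=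
  hg.continuousLinearMap_comp (EuclideanSpace.proj j : Plane →L[ℝ] ℝ)

/-- The Sobolev space `H¹(O)`, realised as the space of pairs `(u, ∇u) ∈ L²(O) × L²(O)²`, where
`∇u` is the weak gradient of `u`. The norm that it inherits is the usual one,
`‖u‖² = ∫ |u|² + ∫ |∇u|²`. -/
def H1 (O : Set Plane) : Submodule ℝ
    (WithLp 2 (Lp ℝ 2 (volume.restrict O) × Lp Plane 2 (volume.restrict O))) where
  carrier := {p | IsWeakGradient O p.fst p.snd}
  zero_mem' := by
    intro φ h1 h2 h3 j
    have e1 : (((0 : WithLp 2 (Lp ℝ 2 (volume.restrict O) × Lp Plane 2 (volume.restrict O))).fst :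
        Plane → ℝ)) =ᵐ[volume.restrict O] 0 := Lp.coeFn_zero _ _ _
    have e2 : (((0 : WithLp 2 (Lp ℝ 2 (volume.restrict O) × Lp Plane 2 (volume.restrict O))).snd :
        Plane → Plane)) =ᵐ[volume.restrict O] 0 := Lp.coeFn_zero _ _ _
    rw [integral_eq_zero_of_ae, integral_eq_zero_of_ae, neg_zero]
    · filter_upwards [e2] with x hx
      change (WithLp.snd 0 : Lp Plane 2 (volume.restrict O)) x j * φ x = 0
      rw [hx, Pi.zero_apply, PiLp.zero_apply, zero_mul]
    · filter_upwards [e1] with x hx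
      change (WithLp.fst 0 : Lp ℝ 2 (volume.restrict O)) x * _ = 0
      rw [hx, Pi.zero_apply, zero_mul]
  add_mem' := by
    intro p q hp hq φ h1 h2 h3 j
    have e1 := Lp.coeFn_add p.fst q.fst
    have e2 := Lp.coeFn_add p.snd q.snd
    have d := memLp_two_fderiv_test (μ := volume.restrict O) h1 h2 (EuclideanSpace.single j 1)
    have d0 := memLp_two_test (μ := volume.restrict O) h1 h2
    have i1 : ∫ x in O, (p + q).fst x * fderiv ℝ φ x (EuclideanSpace.single j 1) =
        (∫ x in O, p.fst x * fderiv ℝ φ x (EuclideanSpace.single j 1)) +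
          ∫ x in O, q.fst x * fderiv ℝ φ x (EuclideanSpace.single j 1) := by
      rw [← integral_add]
      · refine integral_congr_ae ?_
        filter_upwards [e1] with x hx
        rw [WithLp.add_fst, hx, Pi.add_apply, add_mul]
      · exact (Lp.memLp p.fst).integrable_mul d
      · exact (Lp.memLp q.fst).integrable_mul d
    have i2 : ∫ x in O, (p + q).snd x j * φ x =
        (∫ x in O, p.snd x j * φ x) + ∫ x in O, q.snd x j * φ x := by
      rw [← integral_add]
      · refine integral_congr_ae ?_
        filter_upwards [e2] with x hx
        rw [WithLp.add_snd, hx, Pi.add_apply, PiLp.add_apply, add_mul]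
      · exact (memLp_two_coord (Lp.memLp p.snd) j).integrable_mul d0
      · exact (memLp_two_coord (Lp.memLp q.snd) j).integrable_mul d0
    rw [i1, i2, hp φ h1 h2 h3 j, hq φ h1 h2 h3 j, neg_add]
  smul_mem' := by
    intro c p hp φ h1 h2 h3 j
    have e1 := Lp.coeFn_smul c p.fst
    have e2 := Lp.coeFn_smul c p.snd
    have i1 : ∫ x in O, (c • p).fst x * fderiv ℝ φ x (EuclideanSpace.single j 1) =
        c * ∫ x in O, p.fst x * fderiv ℝ φ x (EuclideanSpace.single j 1) := by
      rw [← integral_const_mul]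
      refine integral_congr_ae ?_
      filter_upwards [e1] with x hx
      rw [WithLp.smul_fst, hx, Pi.smul_apply, smul_eq_mul, mul_assoc]
    have i2 : ∫ x in O, (c • p).snd x j * φ x = c * ∫ x in O, p.snd x j * φ x := by
      rw [← integral_const_mul]
      refine integral_congr_ae ?_
      filter_upwards [e2] with x hx
      rw [WithLp.smul_snd, hx, Pi.smul_apply, PiLp.smul_apply, smul_eq_mul, mul_assoc]
    rw [i1, i2, hp φ h1 h2 h3 j, mul_neg]

/-- The function in `L²(O)` underlying an element of `H¹(O)`. -/
def H1.toFun {O : Set Plane} (u : H1 O) : Plane → ℝ := u.1.fst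

/-- The space `H¹(O)²` of vector fields, with the product norm. -/
abbrev H1Vec (O : Set Plane) : Type := PiLp 2 (fun _ : Fin 2 => H1 O)

/-- `g ∈ L²(∂O)` is the trace of `u ∈ H¹(O)`: there are functions in `H¹(O)`, continuous up to the
boundary, that converge to `u` in `H¹(O)` and whose boundary values converge to `g` in `L²(∂O)`.
On a bounded Lipschitz domain each `u` has exactly one trace (up to null sets). -/
def IsTrace (O : Set Plane) (u : H1 O) (g : Plane → ℝ) : Prop :=
  MemLp g 2 (arcLength.restrict (frontier O)) ∧
  ∃ (w : ℕ → H1 O) (c : ℕ → Plane → ℝ),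
    (∀ n, ContinuousOn (c n) (closure O) ∧ H1.toFun (w n) =ᵐ[volume.restrict O] c n) ∧
    Tendsto w atTop (𝓝 u) ∧
    Tendsto (fun n => eLpNorm (fun x => c n x - g x) 2 (arcLength.restrict (frontier O)))
      atTop (𝓝 0)

/-- The componentwise trace of a vector field in `H¹(O)²`. -/
def IsTraceVec (O : Set Plane) (u : H1Vec O) (g : Plane → Plane) : Prop :=
  ∀ k : Fin 2, IsTrace O (u k) (fun x => g x k)

/-- The fields in `H¹(O)²` whose trace vanishes on the part `Γ` of the boundary. -/
def H1VecVanishing (O Γ : Set Plane) : Set (H1Vec O) :=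
  {u | ∃ g, IsTraceVec O u g ∧ ∀ᵐ x ∂(arcLength.restrict Γ), g x = 0}

/-! ### Triangulations and finite element spaces -/

/-- `K` is a (conforming) triangulation of the set `C`. -/
structure IsTriangulation (K : Geometry.SimplicialComplex ℝ Plane) (C : Set Plane) : Prop where
  finite : K.faces.Finite
  pure : ∀ s ∈ K.faces, ∃ t ∈ K.faces, s ⊆ t ∧ t.card = 3
  space_eq : K.space = C

/-- Each triangle of `K` contains a ball of radius at least `κ` times the diameter of the
triangle. -/
def IsShapeRegular (κ : ℝ) (K : Geometry.SimplicialComplex ℝ Plane) : Prop :=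
  ∀ s ∈ K.faces, s.card = 3 → ∃ c : Plane,
    Metric.closedBall c (κ * Metric.diam (s : Set Plane)) ⊆ convexHull ℝ (s : Set Plane)

/-- The edges of the triangulation `K` that lie on `S`. -/
def edgesOn (K : Geometry.SimplicialComplex ℝ Plane) (S : Set Plane) : Set (Finset Plane) :=
  {s | s ∈ K.faces ∧ s.card = 2 ∧ convexHull ℝ (s : Set Plane) ⊆ S}

/-- `K` induces a partition of `S`: the set `S` is the union of the edges of `K` that lie
on it. -/
def InducesPartition (K : Geometry.SimplicialComplex ℝ Plane) (S : Set Plane) : Prop :=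
  S = ⋃ s ∈ edgesOn K S, convexHull ℝ (s : Set Plane)

/-- `p` is a node of the partition of `S` induced by `K`. -/
def IsPartitionNode (K : Geometry.SimplicialComplex ℝ Plane) (S : Set Plane) (p : Plane) : Prop :=
  ∃ s ∈ edgesOn K S, p ∈ s

/-- The continuous piecewise linear vector fields on `K`, as elements of `H¹(O)²`. -/
def P1Cont (K : Geometry.SimplicialComplex ℝ Plane) (O : Set Plane) : Set (H1Vec O) :=
  {u | ∃ v : Plane → Plane, ContinuousOn v (closure O) ∧
    (∀ s ∈ K.faces, s.card = 3 →
      ∃ A : Plane →ᵃ[ℝ] Plane, EqOn v A (convexHull ℝ (s : Set Plane))) ∧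
    ∀ k : Fin 2, H1.toFun (u k) =ᵐ[volume.restrict O] fun x => v x k}

/-- The discrete permeability condition: the discrete Stokes velocities that vanish on
`∂ΩS \ S` contain a family with uniformly bounded `H¹` norm and with flux across `S` (in the
direction pointing out of `ΩS`) bounded below by a positive constant. -/
def DiscretePermeability {ι : Type*} (ΩS S : Set Plane) (V : ι → Submodule ℝ (H1Vec ΩS)) : Prop :=
  ∃ β₀ β₁ : ℝ, 0 < β₀ ∧ 0 < β₁ ∧ ∀ h : ι, ∃ v ∈ V h,
    v ∈ H1VecVanishing ΩS (frontier ΩS \ S) ∧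
    (∃ g, IsTraceVec ΩS v g ∧ β₀ ≤ ∫ x in S, ⟪g x, outwardNormal ΩS x⟫ ∂arcLength) ∧
    ‖v‖ ≤ β₁

end

noncomputable section

/-! The field is a fixed vector `w` times the nodal interpolant `u` of a cone of height 1 and fixed
radius `r` around a node `p` of the interface. The mesh size never enters, so the elements may be
coarser than `r`.

Norm: the cone has Lipschitz constant `1/r`. On a triangle of diameter `d` that contains a ball of
radius `κ d`, the interpolant oscillates by at most `d/r`, and comparing opposite points of the ball
bounds its gradient by `1/(2κr)`. As `0 ≤ u ≤ 1`, the `H¹` norm is bounded by shape regularity and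
the area of the domain alone.

Boundary condition: the support of `u` may leave the ball, but `u` vanishes on every face without a
node in the ball. A point of `∂ΩS \ S` lies in the relative interior of a unique face, and the nodes
of that face are limits of points of `∂ΩS \ S` (`IsTriangulation.mem_closure_of_isRelInterior`). If
the open ball misses `∂ΩS \ S`, it misses these nodes too.

Flux: if `⟪w, ν⟫ ≥ c > 0` on all interface edges with a node in the ball, then `⟪u w, ν⟫ ≥ c u ≥ 0`
almost everywhere on `S`. Since `u p = 1` and the Lipschitz constant is `1/(2κr)`, `u ≥ 1/2` on a
piece of `S` of length `min l (κ r)`. All this is `exists_P1Cont_flux`.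

For a polygonal line, `p` is the first corner, which must be a node of every partition, and `w` is
the sum of the two adjacent normals. It makes a positive product with both, as opposite normals
would force the edges to be collinear. Near the corner the boundary is nothing but these two edges
(`IsLipschitzDomain.frontier_near_corner`), so no other normal occurs. For a line segment, `w` is
its normal and `p` the given node: the boundary outside the interface lies on `∂Ω`, at distance at
least `δ`. -/

/-! ### Boundary charts and normals of Lipschitz domains -/

lemma plane_ext (b : OrthonormalBasis (Fin 2) ℝ Plane) {x y : Plane}
    (h0 : ⟪b 0, x⟫ = ⟪b 0, y⟫) (h1 : ⟪b 1, x⟫ = ⟪b 1, y⟫) : x = y := by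
  refine b.repr.injective (PiLp.ext fun i => ?_)
  rw [b.repr_apply_apply, b.repr_apply_apply]
  fin_cases i <;> assumption

/-- A Lipschitz chart around a boundary point describes the boundary as a graph. -/
lemma IsLipschitzDomain.exists_chart {O : Set Plane} (hO : IsLipschitzDomain O) {x : Plane}
    (hx : x ∈ frontier O) :
    ∃ (b : OrthonormalBasis (Fin 2) ℝ Plane) (γ : ℝ → ℝ), Continuous γ ∧
      (∀ᶠ y in 𝓝 x, (y ∈ O ↔ γ ⟪b 0, y⟫ < ⟪b 1, y⟫)) ∧
      ∀ᶠ y in 𝓝 x, y ∈ frontier O → ⟪b 1, y⟫ = γ ⟪b 0, y⟫ := by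
  obtain ⟨b, γ, L, hγ, h⟩ := hO.lipschitz x hx
  have hc := hγ.continuous
  refine ⟨b, γ, hc, h, ?_⟩
  filter_upwards [eventually_eventually_nhds.2 h] with y hy hyf
  have hyO : y ∉ O := fun h' => by
    rw [hO.isOpen.frontier_eq] at hyf
    exact hyf.2 h'
  refine le_antisymm (not_lt.1 fun h' => hyO (hy.self_of_nhds.2 h')) (not_lt.1 fun h' => ?_)
  have hev : ∀ᶠ z in 𝓝 y, ⟪b 1, z⟫ < γ ⟪b 0, z⟫ :=
    ContinuousAt.eventually_lt (by fun_prop) (by fun_prop) h'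
  have : ∀ᶠ z in 𝓝 y, z ∉ O := by
    filter_upwards [hy, hev] with z h1 h2 h3
    exact lt_asymm h2 (h1.1 h3)
  exact (mem_closure_iff_frequently.1 (frontier_subset_closure hyf)) this

/-- There are no slits: below a boundary point, in the direction `-b 1` of its chart, lie points
outside the closure. This lets the interior of the triangulated set be identified with the domain.
-/
lemma IsLipschitzDomain.interior_closure {O : Set Plane} (hO : IsLipschitzDomain O) :
    interior (closure O) = O := by
  refine Subset.antisymm (fun x hx => ?_) hO.isOpen.subset_interior_closure
  by_contra hxO
  have hxf : x ∈ frontier O := by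
    rw [hO.isOpen.frontier_eq]; exact ⟨interior_subset hx, hxO⟩
  obtain ⟨b, γ, hγ, h1, h2⟩ := hO.exists_chart hxf
  have h3 : ∀ᶠ y in 𝓝 x, y ∈ closure O → γ ⟪b 0, y⟫ ≤ ⟪b 1, y⟫ := by
    filter_upwards [h1, h2] with y hy1 hy2 hy
    by_cases hyO : y ∈ O
    · exact (hy1.1 hyO).le
    · refine (hy2 ?_).ge
      rw [hO.isOpen.frontier_eq]; exact ⟨hy, hyO⟩
  have h4 : Tendsto (fun t : ℝ => x - t • b 1) (𝓝[>] 0) (𝓝 x) := by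
    have : Continuous fun t : ℝ => x - t • b 1 := by fun_prop
    simpa using (this.tendsto 0).mono_left nhdsWithin_le_nhds
  obtain ⟨t, ⟨ht1, ht2⟩, ht⟩ := ((h4.eventually (h3.and (mem_interior_iff_mem_nhds.1 hx))).and
    self_mem_nhdsWithin).exists
  have e := ht1 ht2
  have e2 := h2.self_of_nhds hxf
  have o1 : ⟪b 0, b 1⟫ = 0 := b.orthonormal.2 (by simp)
  have o2 : ⟪b 1, b 1⟫ = 1 := by simp
  simp only [inner_sub_right, inner_smul_right, o1, o2, mul_zero, sub_zero, mul_one, e2] at e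
  have : (0 : ℝ) < t := ht
  linarith

lemma tendsto_add_smul_nhds_zero (x d : Plane) :
    Tendsto (fun t : ℝ => x + t • d) (𝓝 0) (𝓝 x) := by
  have : Continuous fun t : ℝ => x + t • d := by fun_prop
  simpa using this.tendsto 0

/-- A half plane through `x` is a cone at `x`, so its germ there determines all of it. -/
lemma IsOutwardNormal.inner_neg_iff {O : Set Plane} {x n m : Plane} (hn : IsOutwardNormal O x n)
    (hm : IsOutwardNormal O x m) (z : Plane) : ⟪z, n⟫ < 0 ↔ ⟪z, m⟫ < 0 := by
  have h : ∀ᶠ y in 𝓝 x, (⟪y - x, n⟫ < 0 ↔ ⟪y - x, m⟫ < 0) := by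
    filter_upwards [hn.2, hm.2] with y h1 h2
    rw [← h1, h2]
  obtain ⟨t, ht, ht0⟩ := ((((tendsto_add_smul_nhds_zero x z).mono_left
    (nhdsWithin_le_nhds (s := Ioi 0))).eventually h).and self_mem_nhdsWithin).exists
  have ht0 : 0 < t := ht0
  simpa [inner_smul_left, mul_neg_iff, ht0, ht0.not_gt] using ht

lemma IsOutwardNormal.unique {O : Set Plane} {x n m : Plane} (hn : IsOutwardNormal O x n)
    (hm : IsOutwardNormal O x m) : n = m := by
  have hnn : ⟪n, n⟫ = 1 := by simp [hn.1]
  have hmm : ⟪m, m⟫ = 1 := by simp [hm.1]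
  -- Unless `⟪n, m⟫ = 1`, the vector `n - m` has positive product with `n` and negative product with
  -- `m`.
  have h := hn.inner_neg_iff hm (n - m)
  have hc : ⟪m, n⟫ = ⟪n, m⟫ := real_inner_comm _ _
  rw [inner_sub_left, inner_sub_left, hnn, hmm, hc] at h
  have hle : ⟪n, m⟫ ≤ 1 := by
    simpa [hn.1, hm.1] using real_inner_le_norm n m
  refine (inner_eq_one_iff_of_norm_eq_one hn.1 hm.1).1 (le_antisymm hle (not_lt.1 fun h' => ?_))
  have := h.2 (by linarith)
  linarith

lemma IsOutwardNormal.outwardNormal_eq {O : Set Plane} {x n : Plane}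
    (hn : IsOutwardNormal O x n) : outwardNormal O x = n := by
  have h : ∃ n, IsOutwardNormal O x n := ⟨n, hn⟩
  rw [outwardNormal, dif_pos h]
  exact h.choose_spec.unique hn

lemma eventually_add_smul_mem_openSegment {A B x : Plane} (hx : x ∈ openSegment ℝ A B) :
    ∀ᶠ t : ℝ in 𝓝 0, x + t • (B - A) ∈ openSegment ℝ A B := by
  rw [openSegment_eq_image'] at hx
  obtain ⟨s, hs, rfl⟩ := hx
  have : Tendsto (fun t : ℝ => s + t) (𝓝 0) (𝓝 s) := by
    have : Continuous fun t : ℝ => s + t := by fun_prop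
    simpa using this.tendsto 0
  filter_upwards [this.eventually (isOpen_Ioo.mem_nhds hs)] with t ht
  rw [openSegment_eq_image']
  exact ⟨s + t, ht, by simp only [add_smul]; abel⟩

/-- Segments in a Lipschitz graph are not vertical. -/
lemma inner_ne_zero_of_graph (b : OrthonormalBasis (Fin 2) ℝ Plane) {γ : ℝ → ℝ} {x d : Plane}
    {t : ℝ} (ht : t ≠ 0) (hd : d ≠ 0) (hx : ⟪b 1, x⟫ = γ ⟪b 0, x⟫)
    (h : ⟪b 1, x + t • d⟫ = γ ⟪b 0, x + t • d⟫) : ⟪b 0, d⟫ ≠ 0 := by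
  intro h0
  refine hd (plane_ext b (by simpa using h0) ?_)
  simp only [inner_add_right, inner_smul_right, h0, mul_zero, add_zero, ← hx] at h
  simpa [ht] using h

/-- At the points of an open segment on its boundary, a Lipschitz domain is flat. -/
lemma IsLipschitzDomain.exists_isOutwardNormal {O : Set Plane} (hO : IsLipschitzDomain O)
    {A B : Plane} (hAB : A ≠ B) (h : openSegment ℝ A B ⊆ frontier O) {x : Plane}
    (hx : x ∈ openSegment ℝ A B) : ∃ n, IsOutwardNormal O x n := by
  obtain ⟨b, γ, hγ, h1, h2⟩ := hO.exists_chart (h hx)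
  set d := B - A with hd
  have hd0 : d ≠ 0 := sub_ne_zero.2 hAB.symm
  have hx0 := h2.self_of_nhds (h hx)
  have hline : ∀ᶠ t : ℝ in 𝓝 0, ⟪b 1, x + t • d⟫ = γ ⟪b 0, x + t • d⟫ := by
    filter_upwards [eventually_add_smul_mem_openSegment hx,
      (tendsto_add_smul_nhds_zero x d).eventually h2] with t ht1 ht2
    exact ht2 (h ht1)
  have hb : ⟪b 0, d⟫ ≠ 0 := by
    obtain ⟨t, ht, ht0⟩ := ((hline.filter_mono (nhdsWithin_le_nhds (s := {0}ᶜ))).and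
      self_mem_nhdsWithin).exists
    exact inner_ne_zero_of_graph b ht0 hd0 hx0 ht
  set m := ⟪b 1, d⟫ / ⟪b 0, d⟫ with hm
  -- The boundary is locally the line of slope `m` in the chart. `N` is perpendicular to it and
  -- points down, away from the domain.
  set N := m • b 0 - b 1 with hN
  have hN0 : N ≠ 0 := by
    intro h0
    have := congrArg (fun z => ⟪b 1, z⟫) h0
    have o1 : ⟪b 1, b 0⟫ = 0 := b.orthonormal.2 (by simp)
    simp [hN, inner_sub_right, inner_smul_right, o1] at this
  have hNp : 0 < ‖N‖ := norm_pos_iff.2 hN0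
  refine ⟨‖N‖⁻¹ • N, by rw [norm_smul, norm_inv, norm_norm, inv_mul_cancel₀ hNp.ne'], ?_⟩
  -- This is the parameter of the point of the line that has the same abscissa as `y`.
  have htend : Tendsto (fun y : Plane => ⟪b 0, y - x⟫ / ⟪b 0, d⟫) (𝓝 x) (𝓝 0) := by
    have : Continuous (fun y : Plane => ⟪b 0, y - x⟫ / ⟪b 0, d⟫) := by fun_prop
    simpa using this.tendsto x
  filter_upwards [h1, htend.eventually hline] with y hy1 hy2
  have e0 : ⟪b 0, x + (⟪b 0, y - x⟫ / ⟪b 0, d⟫) • d⟫ = ⟪b 0, y⟫ := by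
    rw [inner_add_right, inner_smul_right, div_mul_cancel₀ _ hb, inner_sub_right]; ring
  have e1 : ⟪y - x, N⟫ = m * ⟪b 0, y - x⟫ - ⟪b 1, y - x⟫ := by
    rw [hN, inner_sub_right, inner_smul_right, real_inner_comm (b 0), real_inner_comm (b 1)]
  have e2 : ⟪b 1, x + (⟪b 0, y - x⟫ / ⟪b 0, d⟫) • d⟫ = ⟪b 1, x⟫ + m * ⟪b 0, y - x⟫ := by
    rw [inner_add_right, inner_smul_right, hm]; ring
  have e3 : ⟪b 1, y - x⟫ = ⟪b 1, y⟫ - ⟪b 1, x⟫ := inner_sub_right _ _ _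
  rw [hy1, ← e0, ← hy2, e2, inner_smul_right, e1, e3]
  rw [show ∀ a : ℝ, ‖N‖⁻¹ * a < 0 ↔ a < 0 from fun a => by
    rw [mul_neg_iff]; simp [hNp, hNp.le]]
  constructor <;> intro h <;> linarith

/-- Small steps along the segment in either direction stay out of the open set, so the slope against
`n` can have neither sign. -/
lemma IsOutwardNormal.inner_sub_eq_zero {O : Set Plane} (hO : IsOpen O) {A B : Plane}
    (h : openSegment ℝ A B ⊆ frontier O) {x n : Plane} (hx : x ∈ openSegment ℝ A B)
    (hn : IsOutwardNormal O x n) : ⟪B - A, n⟫ = 0 := by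
  have hev : ∀ᶠ t : ℝ in 𝓝 0, ¬ t * ⟪B - A, n⟫ < 0 := by
    filter_upwards [eventually_add_smul_mem_openSegment hx,
      (tendsto_add_smul_nhds_zero x (B - A)).eventually hn.2] with t h1 h2 h3
    have := h h1
    rw [hO.frontier_eq] at this
    exact this.2 (h2.2 (by simpa [inner_smul_left] using h3))
  obtain ⟨t, ht, ht0⟩ := ((hev.filter_mono (nhdsWithin_le_nhds (s := Ioi 0))).and
    self_mem_nhdsWithin).exists
  obtain ⟨s, hs, hs0⟩ := ((hev.filter_mono (nhdsWithin_le_nhds (s := Iio 0))).and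
    self_mem_nhdsWithin).exists
  have ht0 : 0 < t := ht0
  have hs0 : s < 0 := hs0
  rcases lt_trichotomy ⟪B - A, n⟫ 0 with h | h | h
  · exact absurd (mul_neg_of_pos_of_neg ht0 h) ht
  · exact h
  · exact absurd (mul_neg_of_neg_of_pos hs0 h) hs

/-- The outward normal is constant along an open segment on the boundary. -/
lemma IsLipschitzDomain.exists_normal_segment {O : Set Plane} (hO : IsLipschitzDomain O)
    {A B : Plane} (hAB : A ≠ B) (h : openSegment ℝ A B ⊆ frontier O) :
    ∃ n : Plane, ‖n‖ = 1 ∧ ⟪B - A, n⟫ = 0 ∧ ∀ x ∈ openSegment ℝ A B, outwardNormal O x = n := by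
  -- The half plane that describes the set near `x` also describes it near each close point of the
  -- segment, since the segment is perpendicular to `n`.
  have hloc : ∀ x ∈ openSegment ℝ A B,
      ∀ᶠ y in 𝓝[openSegment ℝ A B] x, outwardNormal O x = outwardNormal O y := by
    intro x hx
    obtain ⟨n, hn⟩ := hO.exists_isOutwardNormal hAB h hx
    have hperp := hn.inner_sub_eq_zero hO.isOpen h hx
    filter_upwards [(eventually_eventually_nhds.2 hn.2).filter_mono nhdsWithin_le_nhds,
      self_mem_nhdsWithin] with y hy hyAB
    have hyx : ⟪y - x, n⟫ = 0 := by
      rw [openSegment_eq_image'] at hx hyAB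
      obtain ⟨s, -, rfl⟩ := hx
      obtain ⟨t, -, rfl⟩ := hyAB
      rw [show A + t • (B - A) - (A + s • (B - A)) = (t - s) • (B - A) by
        rw [sub_smul]; abel, inner_smul_left, hperp, mul_zero]
    have : IsOutwardNormal O y n := by
      refine ⟨hn.1, hy.mono fun z hz => ?_⟩
      rw [hz, show z - x = (z - y) + (y - x) by abel, inner_add_left, hyx, add_zero]
    rw [hn.outwardNormal_eq, this.outwardNormal_eq]
  have hmem : midpoint ℝ A B ∈ openSegment ℝ A B := by
    rw [openSegment_eq_image_lineMap]
    exact ⟨1 / 2, by norm_num, by simp [midpoint]⟩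
  obtain ⟨n, hn⟩ := hO.exists_isOutwardNormal hAB h hmem
  refine ⟨n, hn.1, hn.inner_sub_eq_zero hO.isOpen h hmem, fun x hx => ?_⟩
  rw [← hn.outwardNormal_eq]
  exact (convex_openSegment A B).isPreconnected.induction₂
    (fun x y => outwardNormal O x = outwardNormal O y) hloc
    (fun _ _ _ _ _ _ h1 h2 => h1.trans h2) (fun _ _ _ _ h1 => h1.symm) hx hmem

lemma collinear_of_add_smul {p d₁ d₂ : Plane} {s t : ℝ} (hs : s ≠ 0) (h : s • d₁ = t • d₂) :
    Collinear ℝ {p + d₁, p, p + d₂} := by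
  rw [collinear_iff_of_mem (p₀ := p) (by simp)]
  refine ⟨d₂, ?_⟩
  have : d₁ = (s⁻¹ * t) • d₂ := by rw [mul_smul, ← h, smul_smul, inv_mul_cancel₀ hs, one_smul]
  rintro q (rfl | rfl | rfl)
  · exact ⟨s⁻¹ * t, by simp [this, add_comm]⟩
  · exact ⟨0, by simp⟩
  · exact ⟨1, by simp [add_comm]⟩

/-- Near a corner, the boundary of a Lipschitz domain consists of the two edges that meet
there. -/
lemma IsLipschitzDomain.frontier_near_corner {O : Set Plane} (hO : IsLipschitzDomain O)
    {P₀ P₁ P₂ : Plane} (h : ¬ Collinear ℝ {P₀, P₁, P₂}) (h0 : segment ℝ P₀ P₁ ⊆ frontier O)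
    (h2 : segment ℝ P₁ P₂ ⊆ frontier O) :
    ∀ᶠ y in 𝓝 P₁, y ∈ frontier O → y ∈ segment ℝ P₀ P₁ ∪ segment ℝ P₁ P₂ := by
  have hP1 : P₁ ∈ frontier O := h2 (left_mem_segment ℝ _ _)
  obtain ⟨b, γ, hγ, -, hc⟩ := hO.exists_chart hP1
  have hx0 := hc.self_of_nhds hP1
  set d₁ := P₀ - P₁ with hd1
  set d₂ := P₂ - P₁ with hd2
  have e0 : P₁ + d₁ = P₀ := by simp [hd1]
  have e2 : P₁ + d₂ = P₂ := by simp [hd2]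
  have hcol : ∀ s t : ℝ, s ≠ 0 → s • d₁ ≠ t • d₂ := fun s t hs hst => h (by
    have := collinear_of_add_smul (p := P₁) hs hst
    rwa [e0, e2] at this)
  have hd10 : d₁ ≠ 0 := fun h' => hcol 1 0 one_ne_zero (by simp [h'])
  have hd20 : d₂ ≠ 0 := fun h' => hcol 0 1 (by
    intro _; exact h (by
      have : P₂ = P₁ := by rw [← e2, h', add_zero]
      subst this; simpa using collinear_pair ℝ P₀ P₂)) (by simp [h'])
  have key : ∀ d : Plane, d ≠ 0 → segment ℝ P₁ (P₁ + d) ⊆ frontier O → ⟪b 0, d⟫ ≠ 0 ∧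
      ∀ᶠ t : ℝ in 𝓝 0, 0 ≤ t → P₁ + t • d ∈ segment ℝ P₁ (P₁ + d) ∧
        ⟪b 1, P₁ + t • d⟫ = γ ⟪b 0, P₁ + t • d⟫ := by
    intro d hd hseg
    have hev : ∀ᶠ t : ℝ in 𝓝 0, 0 ≤ t → P₁ + t • d ∈ segment ℝ P₁ (P₁ + d) ∧
        ⟪b 1, P₁ + t • d⟫ = γ ⟪b 0, P₁ + t • d⟫ := by
      filter_upwards [(tendsto_add_smul_nhds_zero P₁ d).eventually hc,
        eventually_le_nhds (zero_lt_one' ℝ)] with t h1 h2 h3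
      have : P₁ + t • d ∈ segment ℝ P₁ (P₁ + d) := by
        rw [segment_eq_image']; exact ⟨t, ⟨h3, h2⟩, by simp⟩
      exact ⟨this, h1 (hseg this)⟩
    refine ⟨?_, hev⟩
    obtain ⟨t, ht, ht0⟩ := ((hev.filter_mono (nhdsWithin_le_nhds (s := Ioi 0))).and
      self_mem_nhdsWithin).exists
    have ht0 : 0 < t := ht0
    exact inner_ne_zero_of_graph b ht0.ne' hd hx0 (ht ht0.le).2
  obtain ⟨hb1, ev1⟩ := key d₁ hd10 (by rwa [e0, segment_symm])
  obtain ⟨hb2, ev2⟩ := key d₂ hd20 (by rwa [e2])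
  have tend : ∀ d : Plane, Tendsto (fun y : Plane => ⟪b 0, y - P₁⟫ / ⟪b 0, d⟫) (𝓝 P₁) (𝓝 0) := by
    intro d
    have : Continuous (fun y : Plane => ⟪b 0, y - P₁⟫ / ⟪b 0, d⟫) := by fun_prop
    simpa using this.tendsto P₁
  have fin : ∀ d : Plane, ⟪b 0, d⟫ ≠ 0 → ∀ y : Plane, ⟪b 1, y⟫ = γ ⟪b 0, y⟫ →
      ⟪b 1, P₁ + (⟪b 0, y - P₁⟫ / ⟪b 0, d⟫) • d⟫ = γ ⟪b 0, P₁ + (⟪b 0, y - P₁⟫ / ⟪b 0, d⟫) • d⟫ →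
      P₁ + (⟪b 0, y - P₁⟫ / ⟪b 0, d⟫) • d = y := by
    intro d hd y hy hyd
    have e0 : ⟪b 0, P₁ + (⟪b 0, y - P₁⟫ / ⟪b 0, d⟫) • d⟫ = ⟪b 0, y⟫ := by
      rw [inner_add_right, inner_smul_right, div_mul_cancel₀ _ hd, inner_sub_right]; ring
    exact plane_ext b e0 (by rw [hyd, e0, hy])
  -- If both edges left the corner towards the same side, they would share the points of the graph
  -- above a common abscissa and be collinear.
  have hopp : ⟪b 0, d₁⟫ * ⟪b 0, d₂⟫ < 0 := by
    refine lt_of_le_of_ne (not_lt.1 fun hpos => ?_) (mul_ne_zero hb1 hb2)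
    have h12 : 0 < ⟪b 0, d₁⟫ / ⟪b 0, d₂⟫ := by
      rw [div_pos_iff]
      exact mul_pos_iff.1 hpos
    have t2 : Tendsto (fun t : ℝ => t * (⟪b 0, d₁⟫ / ⟪b 0, d₂⟫)) (𝓝 0) (𝓝 0) := by
      have : Continuous (fun t : ℝ => t * (⟪b 0, d₁⟫ / ⟪b 0, d₂⟫)) := by fun_prop
      simpa using this.tendsto 0
    obtain ⟨t, ⟨ht1, ht2⟩, ht0⟩ := (((ev1.and (t2.eventually ev2)).filter_mono
      (nhdsWithin_le_nhds (s := Ioi 0))).and self_mem_nhdsWithin).exists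
    have ht0 : 0 < t := ht0
    have f1 := (ht1 ht0.le).2
    have f2 := (ht2 (by positivity)).2
    refine hcol t (t * (⟪b 0, d₁⟫ / ⟪b 0, d₂⟫)) ht0.ne' (add_left_cancel (a := P₁) (plane_ext b ?_ ?_))
    · simp only [inner_add_right, inner_smul_right]
      field_simp
    · rw [f1, f2]
      simp only [inner_add_right, inner_smul_right]
      congr 1
      field_simp
  -- The edges cover both sides of the corner, so a nearby boundary point is the point of one of
  -- them at the same abscissa.
  filter_upwards [hc, (tend d₁).eventually ev1, (tend d₂).eventually ev2] with y hy h1 h2 hyf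
  have hyg := hy hyf
  by_cases hs : 0 ≤ ⟪b 0, y - P₁⟫ / ⟪b 0, d₁⟫
  · left
    obtain ⟨m, g⟩ := h1 hs
    rw [fin d₁ hb1 y hyg g, e0, segment_symm] at m
    exact m
  · right
    have hs2 : 0 ≤ ⟪b 0, y - P₁⟫ / ⟪b 0, d₂⟫ := by
      rw [not_le, div_neg_iff] at hs
      rw [div_nonneg_iff]
      rw [mul_neg_iff] at hopp
      rcases hopp with ⟨p1, p2⟩ | ⟨p1, p2⟩ <;> rcases hs with ⟨q1, q2⟩ | ⟨q1, q2⟩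
      · exact absurd p1 q2.not_gt
      · exact Or.inr ⟨q1.le, p2.le⟩
      · exact Or.inl ⟨q1.le, p2.le⟩
      · exact absurd q2 p1.not_gt
    obtain ⟨m, g⟩ := h2 hs2
    rw [fin d₂ hb2 y hyg g, e2] at m
    exact m

/-! ### Relative interiors of simplices -/

/-- `x` is a convex combination of the points of `s` with positive weights. -/
def IsRelInterior (s : Finset Plane) (x : Plane) : Prop :=
  ∃ w : Plane → ℝ, (∀ q ∈ s, 0 < w q) ∧ ∑ q ∈ s, w q = 1 ∧ ∑ q ∈ s, w q • q = x

lemma IsRelInterior.mem_convexHull {s : Finset Plane} {x : Plane} (h : IsRelInterior s x) :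
    x ∈ convexHull ℝ (s : Set Plane) := by
  obtain ⟨w, h1, h2, h3⟩ := h
  exact Finset.mem_convexHull'.2 ⟨w, fun q hq => (h1 q hq).le, h2, h3⟩

lemma AffineMap.apply_sum_smul (A : Plane →ᵃ[ℝ] ℝ) {s : Finset Plane} {w : Plane → ℝ}
    (hw : ∑ q ∈ s, w q = 1) : A (∑ q ∈ s, w q • q) = ∑ q ∈ s, w q * A q := by
  have h : ∀ z, A z = A.linear z + A 0 := fun z => congrFun A.decomp z
  rw [h, map_sum]
  have e : ∑ q ∈ s, w q * A q = ∑ q ∈ s, (A.linear (w q • q) + w q * A 0) :=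
    Finset.sum_congr rfl fun q _ => by rw [h q, map_smul, smul_eq_mul, mul_add]
  rw [e, Finset.sum_add_distrib, ← Finset.sum_mul, hw, one_mul]

/-- Values on affinely independent points are interpolated by an affine function. -/
lemma exists_affineMap_eqOn {s : Finset Plane}
    (hs : AffineIndependent ℝ ((↑) : s → Plane)) (φ : Plane → ℝ) :
    ∃ A : Plane →ᵃ[ℝ] ℝ, ∀ q ∈ s, A q = φ q := by
  obtain ⟨t, hst, ht, htop⟩ := exists_subset_affineIndependent_affineSpan_eq_top (k := ℝ) hs
  have hst' : ∀ q ∈ s, q ∈ t := fun q hq => hst (by simpa using hq)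
  -- After extension to an affine basis, the barycentric coordinates are affine functions on the
  -- whole plane.
  let b : AffineBasis t ℝ Plane := ⟨(↑), ht, by simpa using htop⟩
  refine ⟨∑ q ∈ s.attach, φ q • b.coord ⟨q, hst' q q.2⟩, fun p hp => ?_⟩
  have e : ∀ q ∈ s.attach, (φ q • b.coord ⟨q, hst' q q.2⟩) p =
      if q = ⟨p, hp⟩ then φ p else 0 := by
    intro q _
    split_ifs with h
    · subst h
      have h1 : b.coord ⟨p, hst' p hp⟩ p = 1 := b.coord_apply_eq ⟨p, hst' p hp⟩
      rw [AffineMap.coe_smul, Pi.smul_apply, h1, smul_eq_mul, mul_one]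
    · have h1 : b.coord ⟨q, hst' q q.2⟩ p = 0 := b.coord_apply_ne (j := ⟨p, hst' p hp⟩)
        fun h' => h (Subtype.ext (congrArg (fun z : t => (z : Plane)) h'))
      rw [AffineMap.coe_smul, Pi.smul_apply, h1, smul_zero]
  have e2 : (∑ q ∈ s.attach, φ q • b.coord ⟨q, hst' q q.2⟩) p =
      ∑ q ∈ s.attach, (φ q • b.coord ⟨q, hst' q q.2⟩) p := by
    generalize s.attach = I
    induction I using Finset.induction_on with
    | empty => simp
    | insert a I ha ih => rw [Finset.sum_insert ha, Finset.sum_insert ha, AffineMap.coe_add, Pi.add_apply, ih]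
  rw [e2, Finset.sum_congr rfl e]
  simp

lemma AffineMap.convexHull_subset_Icc (A : Plane →ᵃ[ℝ] ℝ) {s : Set Plane} {a b : ℝ}
    (h : ∀ q ∈ s, A q ∈ Icc a b) {x : Plane} (hx : x ∈ convexHull ℝ s) : A x ∈ Icc a b :=
  convexHull_min (t := A ⁻¹' Icc a b) h ((convex_Icc a b).affine_preimage A) hx

lemma AffineMap.eqOn_convexHull {A B : Plane →ᵃ[ℝ] ℝ} {s : Set Plane}
    (h : EqOn A B s) : EqOn A B (convexHull ℝ s) := fun x hx => by
  have := AffineMap.convexHull_subset_Icc (A - B) (a := 0) (b := 0)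
    (fun q hq => by simp [h hq]) hx
  simpa [sub_eq_zero] using this

namespace Geometry.SimplicialComplex

variable {K : Geometry.SimplicialComplex ℝ Plane}

/-- The carrier of `x` is obtained by discarding the vertices of weight zero. -/
lemma exists_isRelInterior {t : Finset Plane} (ht : t ∈ K.faces) {x : Plane}
    (hx : x ∈ convexHull ℝ (t : Set Plane)) :
    ∃ s ∈ K.faces, s ⊆ t ∧ IsRelInterior s x := by
  classical
  obtain ⟨w, h1, h2, h3⟩ := Finset.mem_convexHull'.1 hx
  have e : ∀ q ∈ t, q ∉ t.filter (0 < w ·) → w q = 0 := fun q hq hq' =>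
    le_antisymm (not_lt.1 fun h => hq' (Finset.mem_filter.2 ⟨hq, h⟩)) (h1 q hq)
  have s1 : ∑ q ∈ t.filter (0 < w ·), w q = 1 := by
    rw [← h2]; exact Finset.sum_subset (Finset.filter_subset _ _) e
  refine ⟨t.filter (0 < w ·), K.down_closed ht (Finset.filter_subset _ _) ?_,
    Finset.filter_subset _ _, w, fun q hq => (Finset.mem_filter.1 hq).2, s1, ?_⟩
  · by_contra h
    rw [Finset.not_nonempty_iff_eq_empty.1 h] at s1
    simp at s1
  · rw [← h3]
    exact Finset.sum_subset (Finset.filter_subset _ _) fun q hq hq' => by simp [e q hq hq']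

/-- For a vertex `q` of `s` outside `t`, the barycentric coordinate of `q` vanishes on the hull of
`s ∩ t`, which contains `x`, whereas `x` has positive weight at `q`. -/
lemma subset_of_isRelInterior {s t : Finset Plane} (hs : s ∈ K.faces) (ht : t ∈ K.faces)
    {x : Plane} (hx : IsRelInterior s x) (hxt : x ∈ convexHull ℝ (t : Set Plane)) : s ⊆ t := by
  classical
  intro q hq
  by_contra hqt
  obtain ⟨A, hA⟩ := exists_affineMap_eqOn (K.indep hs) (fun p => if p = q then 1 else 0)
  have h0 := AffineMap.convexHull_subset_Icc A (a := 0) (b := 0) (fun p hp => by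
    have : p ≠ q := fun h => hqt (h ▸ hp.2)
    simp [hA p hp.1, this]) (K.inter_subset_convexHull hs ht ⟨hx.mem_convexHull, hxt⟩)
  obtain ⟨w, h1, h2, rfl⟩ := hx
  rw [AffineMap.apply_sum_smul A h2, Finset.sum_congr rfl fun p hp => by rw [hA p hp]] at h0
  simp only [mul_ite, mul_one, mul_zero, Finset.sum_ite_eq', hq, if_true] at h0
  exact (h1 q hq).not_ge h0.2

end Geometry.SimplicialComplex

lemma IsRelInterior.smul_add_smul {s : Finset Plane} {x q : Plane} (hx : IsRelInterior s x)
    (hq : q ∈ s) {t : ℝ} (h0 : 0 ≤ t) (h1 : t < 1) :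
    IsRelInterior s ((1 - t) • x + t • q) := by
  classical
  obtain ⟨w, w1, w2, rfl⟩ := hx
  refine ⟨fun p => (1 - t) * w p + t * if p = q then 1 else 0, fun p hp => ?_, ?_, ?_⟩
  · have := mul_pos (sub_pos.2 h1) (w1 p hp)
    have h2 : 0 ≤ t * if p = q then 1 else 0 := mul_nonneg h0 (by split_ifs <;> norm_num)
    exact add_pos_of_pos_of_nonneg this h2
  · rw [Finset.sum_add_distrib, ← Finset.mul_sum, ← Finset.mul_sum, w2]
    simp [hq]
  · simp only [add_smul, Finset.sum_add_distrib, mul_smul, ← Finset.smul_sum]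
    simp [hq, ite_smul]

/-- All weights of `x` exceed a small multiple `ε` of those of `y`; normalizing the differences
gives `b`. Hence a homothety centred in the simplex takes `y` to `x`. -/
lemma IsRelInterior.exists_eq_smul_add_smul {s : Finset Plane} {x y : Plane}
    (hx : IsRelInterior s x) (hy : IsRelInterior s y) :
    ∃ b ∈ convexHull ℝ (s : Set Plane), ∃ ε : ℝ, 0 < ε ∧ ε < 1 ∧ x = (1 - ε) • b + ε • y := by
  obtain ⟨w, w1, w2, rfl⟩ := hx
  obtain ⟨v, v1, v2, rfl⟩ := hy
  have hev : ∀ᶠ ε in 𝓝[>] (0 : ℝ), ∀ q ∈ s, ε ≤ w q :=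
    (Finset.eventually_all s).2 fun q hq => (eventually_le_nhds (w1 q hq)).filter_mono
      nhdsWithin_le_nhds
  obtain ⟨ε, ⟨hε, hε1⟩, hε0⟩ := ((hev.and ((eventually_lt_nhds (zero_lt_one' ℝ)).filter_mono
    nhdsWithin_le_nhds)).and self_mem_nhdsWithin).exists
  have hε0 : 0 < ε := hε0
  have hne : 1 - ε ≠ 0 := by linarith
  refine ⟨∑ q ∈ s, ((1 - ε)⁻¹ * (w q - ε * v q)) • q, Finset.mem_convexHull'.2
    ⟨_, fun q hq => ?_, ?_, rfl⟩, ε, hε0, hε1, ?_⟩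
  · have h1 : v q ≤ 1 := v2 ▸ Finset.single_le_sum (fun p hp => (v1 p hp).le) hq
    have h2 := hε q hq
    exact mul_nonneg (inv_nonneg.2 (by linarith)) (by nlinarith)
  · rw [← Finset.mul_sum, Finset.sum_sub_distrib, ← Finset.mul_sum, w2, v2, mul_one,
      inv_mul_cancel₀ hne]
  · simp only [mul_smul, ← Finset.smul_sum, smul_smul (1 - ε), mul_inv_cancel₀ hne, one_smul,
      sub_smul, Finset.sum_sub_distrib, sub_add_cancel]

namespace Geometry.SimplicialComplex

variable {K : Geometry.SimplicialComplex ℝ Plane}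

lemma isClosed_convexHull_face (s : Finset Plane) :
    IsClosed (convexHull ℝ (s : Set Plane)) :=
  s.finite_toSet.isClosed_convexHull ℝ

/-- If one point in the relative interior of a face is interior to the underlying space, then
all of them are. -/
lemma mem_interior_space (hK : K.faces.Finite) {s : Finset Plane} (hs : s ∈ K.faces)
    {x y : Plane} (hx : IsRelInterior s x) (hy : IsRelInterior s y)
    (h : y ∈ interior K.space) : x ∈ interior K.space := by
  obtain ⟨b, hb, ε, hε0, hε1, hxb⟩ := hx.exists_eq_smul_add_smul hy
  -- By finiteness, faces that come close to `y` contain `y`, hence contain `s` and the centre `b`.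
  -- The homothety of centre `b` and ratio `ε` then maps a neighbourhood of `y` onto one of `x`
  -- without leaving these faces.
  have h1 : ∀ᶠ z in 𝓝 y, ∀ F ∈ K.faces, z ∈ convexHull ℝ (F : Set Plane) →
      y ∈ convexHull ℝ (F : Set Plane) := by
    refine (eventually_all_finite hK).2 fun F _ => ?_
    by_cases hyF : y ∈ convexHull ℝ (F : Set Plane)
    · exact Eventually.of_forall fun _ _ => hyF
    · filter_upwards [(isClosed_convexHull_face F).isOpen_compl.mem_nhds hyF] with z hz hz'
      exact absurd hz' hz
  have htend : Tendsto (fun x' : Plane => y + ε⁻¹ • (x' - x)) (𝓝 x) (𝓝 y) := by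
    have : Continuous (fun x' : Plane => y + ε⁻¹ • (x' - x)) := by fun_prop
    simpa using this.tendsto x
  rw [mem_interior_iff_mem_nhds] at h ⊢
  filter_upwards [htend.eventually h1, htend.eventually h] with x' h2 h3
  obtain ⟨F, hF, hzF⟩ := mem_space_iff.1 h3
  have hsF := subset_of_isRelInterior hs hF hy (h2 F hF hzF)
  have hbF : b ∈ convexHull ℝ (F : Set Plane) := convexHull_mono (by exact_mod_cast hsF) hb
  refine mem_space_iff.2 ⟨F, hF, ?_⟩
  have := (convex_convexHull ℝ (F : Set Plane)) hbF hzF (by linarith : 0 ≤ 1 - ε) hε0.le (by ring)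
  convert this using 1
  rw [smul_add, smul_smul, mul_inv_cancel₀ hε0.ne', one_smul, ← add_assoc, ← hxb]
  abel

end Geometry.SimplicialComplex

open Geometry SimplicialComplex

/-- The nodes of the face that carries a boundary point outside of the interface are limits of
such boundary points. -/
lemma IsTriangulation.mem_closure_of_isRelInterior {K : SimplicialComplex ℝ Plane} {O S : Set Plane}
    (hO : IsLipschitzDomain O) (hK : IsTriangulation K (closure O)) (hS : InducesPartition K S)
    {s : Finset Plane} (hs : s ∈ K.faces) {x : Plane} (hxs : IsRelInterior s x)
    (hx : x ∈ frontier O \ S) {q : Plane} (hq : q ∈ s) : q ∈ closure (frontier O \ S) := by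
  -- Lying in the interior of the triangulated set and lying on `S` are each all-or-nothing along
  -- the relative interior of a face.
  have key : ∀ y, IsRelInterior s y → y ∈ frontier O \ S := by
    intro y hy
    rw [hO.isOpen.frontier_eq]
    refine ⟨⟨?_, fun hyO => ?_⟩, fun hyS => hx.2 ?_⟩
    · rw [← hK.space_eq]
      exact mem_space_iff.2 ⟨s, hs, hy.mem_convexHull⟩
    · have h1 := mem_interior_space hK.finite hs hxs hy
      rw [hK.space_eq, hO.interior_closure] at h1
      have := hx.1
      rw [hO.isOpen.frontier_eq] at this
      exact this.2 (h1 hyO)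
    · rw [hS] at hyS ⊢
      simp only [mem_iUnion, exists_prop] at hyS ⊢
      obtain ⟨e, he, hye⟩ := hyS
      exact ⟨e, he, convexHull_mono (by exact_mod_cast subset_of_isRelInterior hs he.1 hy hye)
        hxs.mem_convexHull⟩
  have htend : Tendsto (fun t : ℝ => (1 - t) • x + t • q) (𝓝[<] 1) (𝓝 q) := by
    have : Continuous (fun t : ℝ => (1 - t) • x + t • q) := by fun_prop
    simpa using (this.tendsto 1).mono_left nhdsWithin_le_nhds
  refine mem_closure_of_tendsto htend ?_
  filter_upwards [self_mem_nhdsWithin,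
    (eventually_ge_nhds (zero_lt_one' ℝ)).filter_mono nhdsWithin_le_nhds] with t h1 h0
  exact key _ (hxs.smul_add_smul hq h0 h1)

/-! ### Nodal interpolation -/

/-- `u` is affine on each face of `K` and agrees with `φ` at the nodes. -/
def IsNodalInterpolant (K : SimplicialComplex ℝ Plane) (φ u : Plane → ℝ) : Prop :=
  ∀ s ∈ K.faces, ∃ A : Plane →ᵃ[ℝ] ℝ, (∀ q ∈ s, A q = φ q) ∧ EqOn u A (convexHull ℝ (s : Set Plane))

lemma exists_isNodalInterpolant (K : SimplicialComplex ℝ Plane) (φ : Plane → ℝ) :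
    ∃ u, IsNodalInterpolant K φ u := by
  classical
  choose! A hA using fun (s : Finset Plane) (hs : s ∈ K.faces) =>
    exists_affineMap_eqOn (K.indep hs) φ
  refine ⟨fun x => if h : ∃ s ∈ K.faces, x ∈ convexHull ℝ (s : Set Plane) then A h.choose x else 0,
    fun s hs => ⟨A s, hA s hs, fun x hx => ?_⟩⟩
  have h : ∃ s ∈ K.faces, x ∈ convexHull ℝ (s : Set Plane) := ⟨s, hs, hx⟩
  simp only [dif_pos h]
  -- The chosen face does not matter: two faces meet in the hull of their common nodes, where both
  -- affine maps take the values of `φ`.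
  refine AffineMap.eqOn_convexHull (s := (h.choose : Set Plane) ∩ s) (fun q hq => ?_)
    (K.inter_subset_convexHull h.choose_spec.1 hs ⟨h.choose_spec.2, hx⟩)
  rw [hA _ h.choose_spec.1 q hq.1, hA s hs q hq.2]

namespace IsNodalInterpolant

variable {K : SimplicialComplex ℝ Plane} {φ u : Plane → ℝ}

lemma apply_node (hu : IsNodalInterpolant K φ u) {s : Finset Plane} (hs : s ∈ K.faces) {q : Plane}
    (hq : q ∈ s) : u q = φ q := by
  obtain ⟨A, h1, h2⟩ := hu s hs
  rw [h2 (subset_convexHull ℝ _ hq), h1 q hq]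

lemma mem_Icc (hu : IsNodalInterpolant K φ u) {s : Finset Plane} (hs : s ∈ K.faces) {a b : ℝ}
    (h : ∀ q ∈ s, φ q ∈ Icc a b) {x : Plane} (hx : x ∈ convexHull ℝ (s : Set Plane)) :
    u x ∈ Icc a b := by
  obtain ⟨A, h1, h2⟩ := hu s hs
  rw [h2 hx]
  exact AffineMap.convexHull_subset_Icc A (fun q hq => h1 q hq ▸ h q hq) hx

lemma continuousOn (hu : IsNodalInterpolant K φ u) (hK : K.faces.Finite) :
    ContinuousOn u K.space := by
  have := hK.to_subtype
  have e : K.space = ⋃ s : K.faces, convexHull ℝ ((s : Finset Plane) : Set Plane) := by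
    simp [SimplicialComplex.space, iUnion_subtype]
  rw [e]
  refine (locallyFinite_of_finite _).continuousOn_iUnion
    (fun s => isClosed_convexHull_face _) fun s => ?_
  obtain ⟨A, -, h2⟩ := hu s s.2
  exact (AffineMap.continuous_of_finiteDimensional A).continuousOn.congr h2

/-- On a shape regular triangulation, nodal interpolation of a Lipschitz function has a
controlled gradient. -/
lemma exists_affineMap_of_card_eq_three (hu : IsNodalInterpolant K φ u) {κ L : ℝ} (hκ : 0 < κ)
    (hreg : IsShapeRegular κ K) (hφ : ∀ p q, |φ p - φ q| ≤ L * ‖p - q‖) (hL : 0 ≤ L)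
    {s : Finset Plane} (hs : s ∈ K.faces) (h3 : s.card = 3) :
    ∃ A : Plane →ᵃ[ℝ] ℝ, EqOn u A (convexHull ℝ (s : Set Plane)) ∧
      ∀ v, |A.linear v| ≤ L / (2 * κ) * ‖v‖ := by
  obtain ⟨A, h1, h2⟩ := hu s hs
  refine ⟨A, h2, fun v => ?_⟩
  set d := Metric.diam (s : Set Plane) with hd
  have hbd : Bornology.IsBounded (s : Set Plane) := s.finite_toSet.isBounded
  have hdpos : 0 < d := by
    obtain ⟨p, hp, q, hq, hpq⟩ := Finset.one_lt_card.1 (by omega : 1 < s.card)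
    exact (dist_pos.2 hpq).trans_le (Metric.dist_le_diam_of_mem hbd hp hq)
  have hnode : ∀ p ∈ (s : Set Plane), ∀ q ∈ (s : Set Plane), A p ∈ Icc (A q - L * d) (A q + L * d) := by
    intro p hp q hq
    have := hφ p q
    have h4 : L * ‖p - q‖ ≤ L * d := mul_le_mul_of_nonneg_left
      (by rw [← dist_eq_norm]; exact Metric.dist_le_diam_of_mem hbd hp hq) hL
    rw [h1 p hp, h1 q hq]
    rw [abs_le] at this
    constructor <;> linarith
  have hosc : ∀ x ∈ convexHull ℝ (s : Set Plane), ∀ y ∈ convexHull ℝ (s : Set Plane),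
      A x - A y ∈ Icc (-(L * d)) (L * d) := by
    intro x hx y hy
    have h5 : ∀ q ∈ (s : Set Plane), A q ∈ Icc (A y - L * d) (A y + L * d) := fun q hq => by
      have := AffineMap.convexHull_subset_Icc A (fun p hp => hnode p hp q hq) hy
      constructor <;> linarith [this.1, this.2]
    have := AffineMap.convexHull_subset_Icc A h5 hx
    constructor <;> linarith [this.1, this.2]
  obtain ⟨c, hc⟩ := hreg s hs h3
  rcases eq_or_ne v 0 with rfl | hv
  · simp
  have hvp : 0 < ‖v‖ := norm_pos_iff.2 hv
  -- With this scaling, `c + r • v` and `c - r • v` are opposite points of the inscribed ball; their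
  -- distance `2κd` produces the factor `2κ`.
  set r := κ * d / ‖v‖ with hr
  have hrp : 0 < r := by positivity
  have hrv : r * ‖v‖ = κ * d := by rw [hr]; field_simp
  have m1 : c + r • v ∈ convexHull ℝ (s : Set Plane) := hc (by
    simp [norm_smul, abs_of_pos hrp, hrv, hd])
  have m2 : c - r • v ∈ convexHull ℝ (s : Set Plane) := hc (by
    simp [norm_smul, abs_of_pos hrp, hrv, hd])
  have h6 := hosc _ m1 _ m2
  have e : A (c + r • v) - A (c - r • v) = 2 * r * A.linear v := by
    have := A.linearMap_vsub (c + r • v) (c - r • v)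
    simp only [vsub_eq_sub] at this
    rw [← this, show c + r • v - (c - r • v) = (2 * r) • v by
      rw [mul_smul, two_smul]; abel, map_smul, smul_eq_mul]
  rw [e, Set.mem_Icc, ← abs_le, abs_mul, abs_of_pos (by positivity : 0 < 2 * r)] at h6
  have : 2 * κ * d * |A.linear v| ≤ L * d * ‖v‖ := by
    calc 2 * κ * d * |A.linear v| = 2 * r * |A.linear v| * ‖v‖ := by
          linear_combination (-2 * |A.linear v|) * hrv
      _ ≤ _ := mul_le_mul_of_nonneg_right h6 hvp.le
  rw [div_mul_eq_mul_div, le_div_iff₀ (by positivity)]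
  nlinarith

end IsNodalInterpolant

/-! ### Lipschitz bounds along segments -/

/-- A continuous function on a segment that is Lipschitz on each set of a finite closed cover is
Lipschitz with the same constant. -/
lemma abs_sub_le_of_finite_cover {ι : Type*} {I : Set ι} (hI : I.Finite) {C : ι → Set Plane}
    (hC : ∀ i ∈ I, IsClosed (C i)) {u : Plane → ℝ} {M : ℝ}
    (hu : ∀ i ∈ I, ∀ x ∈ C i, ∀ y ∈ C i, |u x - u y| ≤ M * ‖x - y‖) {x y : Plane}
    (hcov : segment ℝ x y ⊆ ⋃ i ∈ I, C i) (hcont : ContinuousOn u (segment ℝ x y)) :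
    |u y - u x| ≤ M * ‖y - x‖ := by
  set g : ℝ → Plane := fun t => x + t • (y - x) with hg
  have hgc : Continuous g := by fun_prop
  have hmem : ∀ t ∈ Icc (0 : ℝ) 1, g t ∈ segment ℝ x y := fun t ht => by
    rw [segment_eq_image']; exact ⟨t, ht, rfl⟩
  have hg0 : g 0 = x := by simp [hg]
  have hg1 : g 1 = y := by simp [hg]
  have hdist : ∀ s t, s ≤ t → ‖g t - g s‖ = (t - s) * ‖y - x‖ := fun s t hst => by
    rw [show g t - g s = (t - s) • (y - x) by simp only [hg, sub_smul]; abel, norm_smul,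
      Real.norm_eq_abs, abs_of_nonneg (sub_nonneg.2 hst)]
  have hcg : ContinuousOn (fun t => u (g t)) (Icc 0 1) := hcont.comp hgc.continuousOn hmem
  have key : Icc (0 : ℝ) 1 ⊆ {t | |u (g t) - u x| ≤ M * (t * ‖y - x‖)} := by
    refine IsClosed.Icc_subset_of_forall_exists_gt ?_ (by simp [hg0]) ?_
    · rw [inter_comm]
      have hf : ContinuousOn (fun t => M * (t * ‖y - x‖) - |u (g t) - u x|) (Icc 0 1) :=
        (by fun_prop : Continuous fun t : ℝ => M * (t * ‖y - x‖)).continuousOn.sub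
          (hcg.sub continuousOn_const).abs
      convert hf.preimage_isClosed_of_isClosed isClosed_Icc (isClosed_Ici (a := 0)) using 2
      ext t
      simp
    · rintro t ⟨ht, ht01⟩ b hb
      have hb : t < b := hb
      -- Continuous induction along the segment: one of the finitely many sets is met arbitrarily
      -- soon after `t`, and being closed it contains `g t`, so its bound carries the estimate past
      -- `t`.
      have hex : ∃ i ∈ I, ∃ᶠ s in 𝓝[>] t, g s ∈ C i := by
        by_contra! hno
        have hev : ∀ᶠ s in 𝓝[>] t, ∀ i ∈ I, g s ∉ C i :=
          (eventually_all_finite hI).2 fun i hi => hno i hi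
        obtain ⟨s, hs, hs1⟩ := (hev.and (Ioo_mem_nhdsGT ht01.2)).exists
        have := hcov (hmem s ⟨ht01.1.trans hs1.1.le, hs1.2.le⟩)
        simp only [mem_iUnion, exists_prop] at this
        obtain ⟨i, hi, h⟩ := this
        exact hs i hi h
      obtain ⟨i, hi, hfr⟩ := hex
      have hti : g t ∈ C i := (hC i hi).mem_of_frequently_of_tendsto hfr
        ((hgc.tendsto t).mono_left nhdsWithin_le_nhds)
      obtain ⟨s, hs, hs1⟩ := (hfr.and_eventually (Ioc_mem_nhdsGT hb)).exists
      refine ⟨s, ?_, hs1⟩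
      have h1 := hu i hi _ hs _ hti
      rw [hdist t s hs1.1.le] at h1
      have ht : |u (g t) - u x| ≤ M * (t * ‖y - x‖) := ht
      calc |u (g s) - u x| ≤ |u (g s) - u (g t)| + |u (g t) - u x| := abs_sub_le _ _ _
        _ ≤ M * ((s - t) * ‖y - x‖) + M * (t * ‖y - x‖) := add_le_add h1 ht
        _ = M * (s * ‖y - x‖) := by ring
  have := key (right_mem_Icc.2 zero_le_one)
  simpa [hg1] using this

lemma IsTriangulation.space_eq_iUnion {K : SimplicialComplex ℝ Plane} {C : Set Plane}
    (hK : IsTriangulation K C) :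
    C = ⋃ s ∈ {s | s ∈ K.faces ∧ s.card = 3}, convexHull ℝ ((s : Finset Plane) : Set Plane) := by
  refine Subset.antisymm (fun x hx => ?_) (iUnion₂_subset fun s hs => ?_)
  · rw [← hK.space_eq] at hx
    obtain ⟨s, hs, hxs⟩ := mem_space_iff.1 hx
    obtain ⟨t, ht, hst, h3⟩ := hK.pure s hs
    exact mem_iUnion₂.2 ⟨t, ⟨ht, h3⟩, convexHull_mono (by exact_mod_cast hst) hxs⟩
  · rw [← hK.space_eq]
    exact convexHull_subset_space hs.1

/-- The gradient bounds on the triangles add up along a segment. The segment must stay in the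
domain, which need not be convex. -/
lemma IsNodalInterpolant.abs_sub_le_of_segment_subset {K : SimplicialComplex ℝ Plane}
    {φ u : Plane → ℝ} (hu : IsNodalInterpolant K φ u) {κ L : ℝ} (hκ : 0 < κ)
    (hreg : IsShapeRegular κ K) (hφ : ∀ p q, |φ p - φ q| ≤ L * ‖p - q‖) (hL : 0 ≤ L)
    {C : Set Plane} (hK : IsTriangulation K C) {x y : Plane} (hxy : segment ℝ x y ⊆ C) :
    |u y - u x| ≤ L / (2 * κ) * ‖y - x‖ := by
  refine abs_sub_le_of_finite_cover (hK.finite.subset fun s hs => hs.1)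
    (fun s _ => isClosed_convexHull_face s) (fun s hs p hp q hq => ?_)
    (hK.space_eq_iUnion ▸ hxy) ((hK.space_eq ▸ hu.continuousOn hK.finite).mono hxy)
  obtain ⟨A, hA, hlin⟩ := hu.exists_affineMap_of_card_eq_three hκ hreg hφ hL hs.1 hs.2
  rw [hA hp, hA hq]
  have := A.linearMap_vsub p q
  simp only [vsub_eq_sub] at this
  rw [← this]
  exact hlin _

/-! ### Membership in `H¹` and traces -/

/-- `u` times a test function is globally Lipschitz if `u` is bounded and Lipschitz along the
segments in the domain. -/
lemma exists_lipschitzWith_mul_test {O : Set Plane} (hO : IsOpen O) {u φ : Plane → ℝ} {B M : ℝ}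
    (hB : ∀ x ∈ O, |u x| ≤ B) (hM : ∀ x y, segment ℝ x y ⊆ O → |u y - u x| ≤ M * ‖y - x‖)
    (hB0 : 0 ≤ B) (hM0 : 0 ≤ M)
    (h1 : ContDiff ℝ ∞ φ) (h2 : HasCompactSupport φ) (h3 : tsupport φ ⊆ O) :
    ∃ C, LipschitzWith C fun x => u x * φ x := by
  obtain ⟨ε, hε, hεO⟩ := h2.exists_thickening_subset_open hO h3
  obtain ⟨L, hL⟩ := h1.lipschitzWith_of_hasCompactSupport h2 (by simp)
  obtain ⟨D, hD⟩ := h1.continuous.bounded_above_of_compact_support h2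
  have hD0 : 0 ≤ D := (norm_nonneg _).trans (hD 0)
  simp only [Real.norm_eq_abs] at hD
  have hF : ∀ x, |u x * φ x| ≤ B * D := by
    intro x
    by_cases hx : x ∈ tsupport φ
    · rw [abs_mul]
      exact mul_le_mul (hB x (h3 hx)) (hD x) (abs_nonneg _) hB0
    · rw [image_eq_zero_of_notMem_tsupport hx]
      simpa using mul_nonneg hB0 hD0
  have hC : 0 ≤ B * L + D * M + 2 * (B * D) / ε := by positivity
  have key : ∀ x y, x ∈ tsupport φ →
      |u x * φ x - u y * φ y| ≤ (B * L + D * M + 2 * (B * D) / ε) * ‖x - y‖ := by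
    intro x y hx
    -- Points closer than `ε` are joined by a segment in the domain, where the product estimate
    -- applies. For distant points the bound `2BD` on the difference suffices.
    rcases lt_or_ge ‖x - y‖ ε with hlt | hge
    · have hball : Metric.ball x ε ⊆ O := (Metric.ball_subset_thickening hx ε).trans hεO
      have hyb : y ∈ Metric.ball x ε := by rwa [Metric.mem_ball', dist_eq_norm]
      have hseg : segment ℝ y x ⊆ O := ((convex_ball x ε).segment_subset hyb
        (Metric.mem_ball_self hε)).trans hball
      have e1 : |φ x - φ y| ≤ L * ‖x - y‖ := by
        simpa [Real.dist_eq, dist_eq_norm] using hL.dist_le_mul x y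
      calc |u x * φ x - u y * φ y| = |u x * (φ x - φ y) + φ y * (u x - u y)| := by ring_nf
        _ ≤ |u x * (φ x - φ y)| + |φ y * (u x - u y)| := abs_add_le _ _
        _ ≤ B * (L * ‖x - y‖) + D * (M * ‖x - y‖) := by
          rw [abs_mul, abs_mul]
          exact add_le_add (mul_le_mul (hB x (h3 hx)) e1 (abs_nonneg _) hB0)
            (mul_le_mul (hD y) (hM y x hseg) (abs_nonneg _) hD0)
        _ ≤ _ := by
          have : 0 ≤ 2 * (B * D) / ε * ‖x - y‖ := by positivity
          linarith
    · calc |u x * φ x - u y * φ y| ≤ |u x * φ x| + |u y * φ y| := abs_sub _ _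
        _ ≤ 2 * (B * D) / ε * ε := by
          rw [div_mul_cancel₀ _ hε.ne']; linarith [hF x, hF y]
        _ ≤ 2 * (B * D) / ε * ‖x - y‖ := mul_le_mul_of_nonneg_left hge (by positivity)
        _ ≤ _ := mul_le_mul_of_nonneg_right (by
          have : 0 ≤ B * L + D * M := by positivity
          linarith) (norm_nonneg _)
  refine ⟨_, LipschitzWith.of_dist_le' (K := B * L + D * M + 2 * (B * D) / ε) fun x y => ?_⟩
  rw [Real.dist_eq, dist_eq_norm]
  by_cases hx : x ∈ tsupport φ
  · exact key x y hx
  by_cases hy : y ∈ tsupport φ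
  · rw [abs_sub_comm, norm_sub_rev]
    exact key y x hy
  rw [image_eq_zero_of_notMem_tsupport hx, image_eq_zero_of_notMem_tsupport hy]
  simpa using mul_nonneg hC (norm_nonneg _)

lemma norm_gradient_le {O : Set Plane} (hO : IsOpen O) {u : Plane → ℝ} {M : ℝ} (hM0 : 0 ≤ M)
    (hM : ∀ x y, segment ℝ x y ⊆ O → |u y - u x| ≤ M * ‖y - x‖) {x : Plane} (hx : x ∈ O)
    (hd : DifferentiableAt ℝ u x) : ‖gradient u x‖ ≤ M := by
  rw [gradient, LinearIsometryEquiv.norm_map]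
  refine hd.hasFDerivAt.le_of_lip' hM0 ?_
  obtain ⟨ε, hε, hεO⟩ := Metric.isOpen_iff.1 hO x hx
  filter_upwards [Metric.ball_mem_nhds x hε] with y hy
  exact hM x y (((convex_ball x ε).segment_subset (Metric.mem_ball_self hε) hy).trans hεO)

lemma gradient_apply (u : Plane → ℝ) (x : Plane) (j : Fin 2) :
    gradient u x j = fderiv ℝ u x (EuclideanSpace.single j 1) := by
  have h : ⟪gradient u x, EuclideanSpace.single j (1 : ℝ)⟫ =
      fderiv ℝ u x (EuclideanSpace.single j 1) := by
    rw [gradient, InnerProductSpace.toDual_symm_apply]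
  rw [← h, EuclideanSpace.inner_single_right]
  simp

lemma measurable_gradient (u : Plane → ℝ) : Measurable (gradient u) :=
  (LinearIsometryEquiv.continuous _).measurable.comp (measurable_fderiv ℝ u)

/-- The product of `u` with a test function is globally Lipschitz with compact support, so its
directional derivative has integral zero; the product rule splits that integral. -/
lemma isWeakGradient_gradient {O : Set Plane} (hO : IsOpen O) {u : Plane → ℝ} {B M : ℝ}
    (hB : ∀ x ∈ O, |u x| ≤ B) (hM : ∀ x y, segment ℝ x y ⊆ O → |u y - u x| ≤ M * ‖y - x‖)
    (hB0 : 0 ≤ B) (hM0 : 0 ≤ M) (hu : MemLp u 2 (volume.restrict O))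
    (hg : MemLp (gradient u) 2 (volume.restrict O))
    (hd : ∀ᵐ x ∂volume.restrict O, DifferentiableAt ℝ u x) :
    IsWeakGradient O u (gradient u) := by
  intro φ h1 h2 h3 j
  set v : Plane := EuclideanSpace.single j 1
  obtain ⟨C, hC⟩ := exists_lipschitzWith_mul_test hO hB hM hB0 hM0 h1 h2 h3
  have hcs : HasCompactSupport fun x => u x * φ x := h2.mul_left
  have hz : ∫ x, lineDeriv ℝ (fun x => u x * φ x) x v = 0 := by
    -- Integration by parts against the constant function 1.
    have := (LipschitzWith.const (1 : ℝ) (α := Plane) (β := ℝ)).integral_lineDeriv_mul_eq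
      (μ := volume) hC hcs (-v)
    simpa [lineDeriv] using this.symm
  have hO0 : ∫ x, lineDeriv ℝ (fun x => u x * φ x) x v =
      ∫ x in O, lineDeriv ℝ (fun x => u x * φ x) x v := by
    refine (setIntegral_eq_integral_of_forall_compl_eq_zero fun x hx => ?_).symm
    have hx' : x ∉ tsupport φ := fun h => hx (h3 h)
    have he : (fun x => u x * φ x) =ᶠ[𝓝 x] fun _ => 0 := by
      filter_upwards [(isClosed_tsupport φ).isOpen_compl.mem_nhds hx'] with y hy
      rw [image_eq_zero_of_notMem_tsupport hy, mul_zero]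
    rw [he.lineDeriv_eq]
    simp [lineDeriv]
  have hae : ∫ x in O, lineDeriv ℝ (fun x => u x * φ x) x v =
      ∫ x in O, (u x * fderiv ℝ φ x v + gradient u x j * φ x) := by
    refine integral_congr_ae ?_
    filter_upwards [hd] with x hx
    have hφ : DifferentiableAt ℝ φ x := (h1.differentiable (by simp)) x
    rw [(hx.fun_mul hφ).lineDeriv_eq_fderiv, fderiv_fun_mul hx hφ, gradient_apply]
    simp [v, mul_comm]
  have i1 : Integrable (fun x => u x * fderiv ℝ φ x v) (volume.restrict O) :=
    hu.integrable_mul (memLp_two_fderiv_test h1 h2 v)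
  have i2 : Integrable (fun x => gradient u x j * φ x) (volume.restrict O) :=
    (memLp_two_coord hg j).integrable_mul (memLp_two_test h1 h2)
  rw [integral_add i1 i2, ← hO0, hz] at hae
  linarith

/-- Bounded functions that are Lipschitz along segments belong to `H¹`. -/
lemma exists_H1_of_lipschitz {O : Set Plane} (hO : IsOpen O) (hb : Bornology.IsBounded O)
    {u : Plane → ℝ} {B M : ℝ} (hc : ContinuousOn u O)
    (hB : ∀ x ∈ O, |u x| ≤ B) (hM : ∀ x y, segment ℝ x y ⊆ O → |u y - u x| ≤ M * ‖y - x‖)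
    (hB0 : 0 ≤ B) (hM0 : 0 ≤ M) (hd : ∀ᵐ x ∂volume.restrict O, DifferentiableAt ℝ u x) :
    ∃ U : H1 O, H1.toFun U =ᵐ[volume.restrict O] u ∧
      ‖U‖ ≤ measureUnivNNReal (volume.restrict O) ^ (2 : ℝ≥0∞).toReal⁻¹ * (B + M) := by
  have hfin : IsFiniteMeasure (volume.restrict O) :=
    ⟨by simpa using hb.measure_lt_top⟩
  have hBae : ∀ᵐ x ∂volume.restrict O, ‖u x‖ ≤ B :=
    ae_restrict_of_forall_mem hO.measurableSet hB
  have hMae : ∀ᵐ x ∂volume.restrict O, ‖gradient u x‖ ≤ M := by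
    filter_upwards [hd, ae_restrict_mem hO.measurableSet] with x hx hxO
    exact norm_gradient_le hO hM0 hM hxO hx
  have hu : MemLp u 2 (volume.restrict O) :=
    MemLp.of_bound (hc.aestronglyMeasurable hO.measurableSet) B hBae
  have hg : MemLp (gradient u) 2 (volume.restrict O) :=
    MemLp.of_bound (measurable_gradient u).aestronglyMeasurable M hMae
  have hw := isWeakGradient_gradient hO hB hM hB0 hM0 hu hg hd
  have e1 := hu.coeFn_toLp
  have e2 := hg.coeFn_toLp
  refine ⟨⟨WithLp.toLp 2 (hu.toLp u, hg.toLp (gradient u)), fun φ h1 h2 h3 j => ?_⟩, e1, ?_⟩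
  · calc ∫ x in O, (hu.toLp u : Plane → ℝ) x * fderiv ℝ φ x (EuclideanSpace.single j 1)
        = ∫ x in O, u x * fderiv ℝ φ x (EuclideanSpace.single j 1) :=
          integral_congr_ae (by filter_upwards [e1] with x hx; rw [hx])
      _ = - ∫ x in O, gradient u x j * φ x := hw φ h1 h2 h3 j
      _ = _ := by
        congr 1
        refine integral_congr_ae ?_
        filter_upwards [e2] with x hx
        change _ = (hg.toLp (gradient u) : Plane → Plane) x j * φ x
        rw [hx]
  · have n1 : ‖hu.toLp u‖ ≤ measureUnivNNReal (volume.restrict O) ^ (2 : ℝ≥0∞).toReal⁻¹ * B :=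
      Lp.norm_le_of_ae_bound hB0 (by filter_upwards [e1, hBae] with x h1 h2; rwa [h1])
    have n2 : ‖hg.toLp (gradient u)‖ ≤
        measureUnivNNReal (volume.restrict O) ^ (2 : ℝ≥0∞).toReal⁻¹ * M :=
      Lp.norm_le_of_ae_bound hM0 (by filter_upwards [e2, hMae] with x h1 h2; rwa [h1])
    rw [mul_add]
    refine le_trans ?_ (add_le_add n1 n2)
    rw [Submodule.coe_norm, WithLp.prod_norm_eq_of_L2]
    exact Real.sqrt_le_iff.2 ⟨by positivity, by
      have := mul_nonneg (norm_nonneg (hu.toLp u)) (norm_nonneg (hg.toLp (gradient u)))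
      change ‖hu.toLp u‖ ^ 2 + ‖hg.toLp (gradient u)‖ ^ 2 ≤ _
      nlinarith⟩

lemma H1.toFun_smul {O : Set Plane} (c : ℝ) (U : H1 O) :
    H1.toFun (c • U) =ᵐ[volume.restrict O] fun x => c * H1.toFun U x := by
  filter_upwards [Lp.coeFn_smul c U.1.fst] with x hx
  exact hx

/-! ### Traces of continuous functions -/

lemma isTrace_of_continuousOn {O : Set Plane} (hb : Bornology.IsBounded O)
    (hfin : arcLength (frontier O) < ⊤) {U : H1 O} {u : Plane → ℝ}
    (hc : ContinuousOn u (closure O)) (hU : H1.toFun U =ᵐ[volume.restrict O] u) :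
    IsTrace O U u := by
  have : IsFiniteMeasure (arcLength.restrict (frontier O)) := ⟨by simpa using hfin⟩
  have hcomp : IsCompact (frontier O) :=
    Metric.isCompact_of_isClosed_isBounded isClosed_frontier
      (hb.closure.subset frontier_subset_closure)
  have hcf := hc.mono frontier_subset_closure
  obtain ⟨D, hD⟩ := hcomp.exists_bound_of_continuousOn hcf
  refine ⟨MemLp.of_bound (hcf.aestronglyMeasurable hcomp.measurableSet) D
    (ae_restrict_of_forall_mem hcomp.measurableSet hD), fun _ => U, fun _ => u,
    fun _ => ⟨hc, hU⟩, tendsto_const_nhds, ?_⟩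
  simp

lemma IsPolygonalLipschitzDomain.arcLength_frontier_lt_top {O : Set Plane}
    (hO : IsPolygonalLipschitzDomain O) : arcLength (frontier O) < ⊤ := by
  obtain ⟨F, hF⟩ := hO.polygonal
  rw [hF]
  refine measure_biUnion_lt_top F.finite_toSet fun e _ => ?_
  rw [hausdorffMeasure_segment]
  exact edist_lt_top _ _

/-- The nodal interpolant is differentiable almost everywhere. -/
lemma IsNodalInterpolant.ae_differentiableAt {K : SimplicialComplex ℝ Plane} {φ u : Plane → ℝ}
    (hu : IsNodalInterpolant K φ u) (hK : K.faces.Finite) {O : Set Plane} (hO : MeasurableSet O)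
    (hOK : O ⊆ K.space) :
    ∀ᵐ x ∂volume.restrict O, DifferentiableAt ℝ u x := by
  -- Frontiers of convex sets are null. For edges and nodes this removes the whole face, so each
  -- remaining point is interior to a triangle.
  have h : ∀ᵐ x ∂(volume : Measure Plane), ∀ s ∈ K.faces,
      x ∉ frontier (convexHull ℝ ((s : Finset Plane) : Set Plane)) :=
    (ae_ball_iff hK.countable).2 fun s _ =>
      measure_eq_zero_iff_ae_notMem.1 ((convex_convexHull ℝ _).addHaar_frontier volume)
  filter_upwards [ae_restrict_of_ae h, ae_restrict_mem hO] with x hx hxO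
  obtain ⟨s, hs, hxs⟩ := mem_space_iff.1 (hOK hxO)
  have hint : x ∈ interior (convexHull ℝ (s : Set Plane)) := by
    by_contra hn
    exact hx s hs ⟨subset_closure hxs, hn⟩
  obtain ⟨A, -, hA⟩ := hu s hs
  have he : u =ᶠ[𝓝 x] A := by
    filter_upwards [mem_interior_iff_mem_nhds.1 hint] with y hy using hA hy
  refine DifferentiableAt.congr_of_eventuallyEq ?_ he
  have : (A : Plane → ℝ) = fun z => LinearMap.toContinuousLinearMap A.linear z + A 0 := by
    ext z; exact congrFun A.decomp z
  rw [this]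
  fun_prop

/-! ### Edges of the interface -/

lemma Finset.exists_eq_pair_of_mem {e : Finset Plane} (h : e.card = 2) {q : Plane} (hq : q ∈ e) :
    ∃ b, q ≠ b ∧ e = {q, b} := by
  obtain ⟨a, b, hab, rfl⟩ := Finset.card_eq_two.1 h
  rcases Finset.mem_insert.1 hq with rfl | hq
  · exact ⟨b, hab, rfl⟩
  · rw [Finset.mem_singleton] at hq
    subst hq
    exact ⟨a, hab.symm, Finset.pair_comm _ _⟩

lemma isRelInterior_pair_of_mem_openSegment {a b x : Plane} (hab : a ≠ b)
    (hx : x ∈ openSegment ℝ a b) : IsRelInterior {a, b} x := by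
  obtain ⟨s, t, hs, ht, hst, rfl⟩ := hx
  refine ⟨fun q => if q = a then s else t, fun q _ => ?_, ?_, ?_⟩
  · dsimp only
    split_ifs <;> assumption
  · simp [Finset.sum_pair hab, hab.symm, hst]
  · simp [Finset.sum_pair hab, hab.symm]

lemma IsRelInterior.mem_openSegment {a b x : Plane} (hab : a ≠ b)
    (hx : IsRelInterior {a, b} x) : x ∈ openSegment ℝ a b := by
  obtain ⟨w, h1, h2, h3⟩ := hx
  rw [Finset.sum_pair hab] at h2 h3
  exact ⟨w a, w b, h1 a (by simp), h1 b (by simp), h2, h3⟩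

/-- Supplies a point of an edge near one of its nodes and away from the corners, where the normal of
the edge can be read off. -/
lemma exists_mem_openSegment_of_mem_nhds {a b : Plane} (hab : a ≠ b) {U : Set Plane}
    (hU : U ∈ 𝓝 a) {N : Set Plane} (hN : N.Finite) : ∃ x ∈ openSegment ℝ a b, x ∈ U ∧ x ∉ N := by
  have h1 : ∀ᶠ t : ℝ in 𝓝[>] 0, ∀ y ∈ N, a + t • (b - a) ≠ y := by
    refine (eventually_all_finite hN).2 fun y _ => ?_
    rcases eq_or_ne a y with rfl | hay
    · filter_upwards [self_mem_nhdsWithin] with t ht h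
      have : (t : ℝ) • (b - a) = 0 := by simpa using h
      rcases smul_eq_zero.1 this with h0 | h0
      · exact (ne_of_gt ht) h0
      · exact hab (sub_eq_zero.1 h0).symm
    · exact ((tendsto_add_smul_nhds_zero a (b - a)).eventually_ne hay).filter_mono
        nhdsWithin_le_nhds
  obtain ⟨t, ⟨ht1, ht2⟩, ht3⟩ := ((h1.and (((tendsto_add_smul_nhds_zero a (b - a)).eventually
    hU).filter_mono nhdsWithin_le_nhds)).and (Ioo_mem_nhdsGT (zero_lt_one' ℝ))).exists
  refine ⟨a + t • (b - a), ?_, ht2, fun h => ht1 _ h rfl⟩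
  rw [openSegment_eq_image']
  exact ⟨t, ht3, rfl⟩

lemma openSegment_subset_of_mem_edgesOn {K : SimplicialComplex ℝ Plane} {S : Set Plane}
    {a b : Plane} (h : {a, b} ∈ edgesOn K S) : openSegment ℝ a b ⊆ S := by
  have := h.2.2
  rw [Finset.coe_pair, convexHull_pair] at this
  exact (openSegment_subset_segment ℝ a b).trans this

lemma finite_edgesOn {K : SimplicialComplex ℝ Plane} (hK : K.faces.Finite) (S : Set Plane) :
    (edgesOn K S).Finite :=
  hK.subset fun _ h => h.1

lemma InducesPartition.isClosed {K : SimplicialComplex ℝ Plane} (hK : K.faces.Finite)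
    {S : Set Plane} (hS : InducesPartition K S) : IsClosed S := by
  rw [hS]
  exact (finite_edgesOn hK S).isClosed_biUnion fun s _ => isClosed_convexHull_face s

/-- Almost every point of the interface is interior to an edge. -/
lemma InducesPartition.ae_isRelInterior {K : SimplicialComplex ℝ Plane} (hK : K.faces.Finite)
    {S : Set Plane} (hS : InducesPartition K S) :
    ∀ᵐ x ∂arcLength.restrict S, ∃ e ∈ edgesOn K S, IsRelInterior e x := by
  have hNA : NullSingletonClass arcLength := Measure.nullSingletonClass_hausdorff Plane one_pos
  have hnull : ∀ᵐ x ∂arcLength, ∀ e ∈ edgesOn K S, x ∉ e :=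
    (ae_ball_iff (finite_edgesOn hK S).countable).2 fun e _ =>
      measure_eq_zero_iff_ae_notMem.1 (e.finite_toSet.measure_zero arcLength)
  filter_upwards [ae_restrict_of_ae hnull, ae_restrict_mem (hS.isClosed hK).measurableSet]
    with x hx hxS
  rw [hS] at hxS
  obtain ⟨e, he, hxe⟩ := mem_iUnion₂.1 hxS
  refine ⟨e, he, ?_⟩
  obtain ⟨a, b, hab, rfl⟩ := Finset.card_eq_two.1 he.2.1
  have hxn := hx _ he
  rw [Finset.coe_pair, convexHull_pair] at hxe
  simp only [Finset.mem_insert, Finset.mem_singleton, not_or] at hxn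
  exact isRelInterior_pair_of_mem_openSegment hab
    (mem_openSegment_of_ne_left_right (Ne.symm hxn.1) (Ne.symm hxn.2) hxe)

/-- The normal component of a continuous field is integrable on the interface. -/
lemma InducesPartition.integrableOn_inner_outwardNormal {O S : Set Plane} (hO : IsLipschitzDomain O)
    (hSO : S ⊆ frontier O) {K : SimplicialComplex ℝ Plane} (hK : K.faces.Finite)
    (hS : InducesPartition K S) {g : Plane → Plane} (hg : ContinuousOn g S) :
    IntegrableOn (fun x => ⟪g x, outwardNormal O x⟫) S arcLength := by
  have hNA : NullSingletonClass arcLength := Measure.nullSingletonClass_hausdorff Plane one_pos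
  have key : ∀ e ∈ edgesOn K S, IntegrableOn (fun x => ⟪g x, outwardNormal O x⟫)
      (convexHull ℝ (e : Set Plane)) arcLength := by
    intro e he
    have heS := he.2.2
    obtain ⟨a, b, hab, rfl⟩ := Finset.card_eq_two.1 he.2.1
    rw [Finset.coe_pair, convexHull_pair] at heS ⊢
    obtain ⟨n, -, -, hn⟩ := hO.exists_normal_segment hab
      ((openSegment_subset_of_mem_edgesOn he).trans hSO)
    have hcomp : IsCompact (segment ℝ a b) := by
      rw [← convexHull_pair]
      exact (toFinite _).isCompact_convexHull ℝ
    have hcont : ContinuousOn (fun x => ⟪g x, n⟫) (segment ℝ a b) :=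
      (hg.mono heS).inner continuousOn_const
    obtain ⟨D, hD⟩ := hcomp.exists_bound_of_continuousOn hcont
    have hfin : IsFiniteMeasure (arcLength.restrict (segment ℝ a b)) :=
      ⟨by rw [Measure.restrict_apply_univ, hausdorffMeasure_segment]; exact edist_lt_top _ _⟩
    have hi : IntegrableOn (fun x => ⟪g x, n⟫) (segment ℝ a b) arcLength :=
      Integrable.of_bound (C := D)
        (hcont.aestronglyMeasurable hcomp.measurableSet)
        (ae_restrict_of_forall_mem hcomp.measurableSet hD)
    refine hi.congr ?_
    have hnull : ∀ᵐ x ∂arcLength, x ∉ ({a, b} : Set Plane) :=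
      measure_eq_zero_iff_ae_notMem.1 ((toFinite _).measure_zero arcLength)
    filter_upwards [ae_restrict_of_ae hnull, ae_restrict_mem hcomp.measurableSet] with x hx hxs
    simp only [mem_insert_iff, mem_singleton_iff, not_or] at hx
    rw [hn x (mem_openSegment_of_ne_left_right (Ne.symm hx.1) (Ne.symm hx.2) hxs)]
  have : IntegrableOn (fun x => ⟪g x, outwardNormal O x⟫)
      (⋃ e ∈ edgesOn K S, convexHull ℝ ((e : Finset Plane) : Set Plane)) arcLength :=
    (integrableOn_finite_biUnion (finite_edgesOn hK S)).2 key
  rwa [← hS] at this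

/-! ### The tent function -/

/-- The cone with height `1` at `p` and support of radius `r`. -/
def tent (p : Plane) (r : ℝ) (x : Plane) : ℝ := max 0 (1 - ‖x - p‖ / r)

lemma tent_mem_Icc (p : Plane) {r : ℝ} (hr : 0 < r) (x : Plane) : tent p r x ∈ Icc 0 1 :=
  ⟨le_max_left _ _, max_le zero_le_one (by
    have : 0 ≤ ‖x - p‖ / r := by positivity
    linarith)⟩

lemma tent_self (p : Plane) (r : ℝ) : tent p r p = 1 := by simp [tent]

lemma tent_eq_zero {p : Plane} {r : ℝ} (hr : 0 < r) {x : Plane} (hx : x ∉ Metric.ball p r) :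
    tent p r x = 0 := by
  rw [Metric.mem_ball, not_lt, dist_eq_norm] at hx
  exact max_eq_left (by rw [sub_nonpos, le_div_iff₀ hr]; linarith)

lemma abs_tent_sub_tent_le (p : Plane) {r : ℝ} (hr : 0 < r) (x y : Plane) :
    |tent p r x - tent p r y| ≤ r⁻¹ * ‖x - y‖ := by
  refine (abs_max_sub_max_le_max _ _ _ _).trans (max_le (by simp; positivity) ?_)
  rw [show 1 - ‖x - p‖ / r - (1 - ‖y - p‖ / r) = r⁻¹ * (‖y - p‖ - ‖x - p‖) by ring, abs_mul,
    abs_of_pos (inv_pos.2 hr)]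
  refine mul_le_mul_of_nonneg_left ?_ (inv_pos.2 hr).le
  have := abs_norm_sub_norm_le (y - p) (x - p)
  rwa [sub_sub_sub_cancel_right, norm_sub_rev y x] at this

/-! ### Fields with flux bounded below -/

set_option maxHeartbeats 1000000 in
/-- The nodal interpolants of a tent, multiplied by a fixed vector, have uniformly bounded norm and
flux bounded below. -/
theorem exists_P1Cont_flux {O S : Set Plane} (hO : IsPolygonalLipschitzDomain O)
    (hSO : S ⊆ frontier O) {κ r c l : ℝ} (hκ : 0 < κ) (hr : 0 < r) (hc : 0 < c) (hl : 0 < l)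
    (w : Plane) :
    ∃ β₀ β₁ : ℝ, 0 < β₀ ∧ 0 < β₁ ∧ ∀ K : SimplicialComplex ℝ Plane,
      IsTriangulation K (closure O) → InducesPartition K S → IsShapeRegular κ K →
      ∀ p Q : Plane, IsPartitionNode K S p → segment ℝ p Q ⊆ S → l ≤ ‖Q - p‖ →
      Disjoint (Metric.ball p r) (frontier O \ S) →
      (∀ e ∈ edgesOn K S, ∀ q ∈ e, q ∈ Metric.ball p r → ∀ x, IsRelInterior e x →
        c ≤ ⟪w, outwardNormal O x⟫) →
      ∃ v ∈ P1Cont K O, v ∈ H1VecVanishing O (frontier O \ S) ∧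
        (∃ g, IsTraceVec O v g ∧ β₀ ≤ ∫ x in S, ⟪g x, outwardNormal O x⟫ ∂arcLength) ∧
        ‖v‖ ≤ β₁ := by
  -- `M` is the Lipschitz constant of the interpolant along segments, and `M * (κ * r) = 1/2`. Hence
  -- `u ≥ 1/2` within distance `κ * r` of `p`, which explains `m`.
  set M := r⁻¹ / (2 * κ) with hM
  have hM0 : 0 ≤ M := by positivity
  set D : ℝ := measureUnivNNReal (volume.restrict O) ^ (2 : ℝ≥0∞).toReal⁻¹ * (1 + M) with hD
  have hD0 : 0 ≤ D := by positivity
  set m := min l (κ * r) with hm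
  have hm0 : 0 < m := lt_min hl (by positivity)
  -- The summand 1 only secures positivity of the norm bound.
  refine ⟨m * (c / 2), ‖w‖ * D + 1, by positivity, by positivity, ?_⟩
  intro K hK hS hreg p Q hp hpQ hlQ hdisj hnorm
  obtain ⟨u, hu⟩ := exists_isNodalInterpolant K (tent p r)
  have hLip := abs_tent_sub_tent_le p hr
  have hseg : ∀ x y, segment ℝ x y ⊆ closure O → |u y - u x| ≤ M * ‖y - x‖ := fun x y hxy =>
    hu.abs_sub_le_of_segment_subset hκ hreg hLip (by positivity) hK hxy
  have hcont : ContinuousOn u (closure O) := hK.space_eq ▸ hu.continuousOn hK.finite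
  have hIcc : ∀ x ∈ closure O, u x ∈ Icc (0 : ℝ) 1 := by
    intro x hx
    rw [← hK.space_eq] at hx
    obtain ⟨s, hs, hxs⟩ := mem_space_iff.1 hx
    exact hu.mem_Icc hs (fun q _ => tent_mem_Icc p hr q) hxs
  have hSc : S ⊆ closure O := hSO.trans frontier_subset_closure
  obtain ⟨U, hU, hUn⟩ := exists_H1_of_lipschitz hO.isOpen hO.isBounded (B := 1) (M := M)
    (hcont.mono subset_closure)
    (fun x hx => by
      have := hIcc x (subset_closure hx)
      rw [abs_le]
      constructor <;> linarith [this.1, this.2])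
    (fun x y hxy => hseg x y (hxy.trans subset_closure)) zero_le_one hM0
    (hu.ae_differentiableAt hK.finite hO.isOpen.measurableSet (hK.space_eq ▸ subset_closure))
  set g : Plane → Plane := fun x => u x • w with hg
  have hgc : ContinuousOn g (closure O) := hcont.smul continuousOn_const
  set v : H1Vec O := WithLp.toLp 2 (fun k => w k • U) with hv
  have hvU : ∀ k, H1.toFun (v k) =ᵐ[volume.restrict O] fun x => g x k := by
    intro k
    filter_upwards [H1.toFun_smul (w k) U, hU] with x h1 h2
    change H1.toFun (w k • U) x = _
    rw [h1, h2]
    simp [hg, mul_comm]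
  have htr : IsTraceVec O v g := fun k =>
    isTrace_of_continuousOn hO.isBounded hO.arcLength_frontier_lt_top
      ((EuclideanSpace.proj k : Plane →L[ℝ] ℝ).continuous.comp_continuousOn hgc) (hvU k)
  refine ⟨v, ⟨g, hgc, fun s hs h3 => ?_, hvU⟩, ⟨g, htr, ?_⟩, ⟨g, htr, ?_⟩, ?_⟩
  · obtain ⟨A, -, hA⟩ := hu s hs
    refine ⟨(LinearMap.toSpanSingleton ℝ Plane w).toAffineMap.comp A, fun x hx => ?_⟩
    simp [hg, hA hx]
  · refine ae_restrict_of_forall_mem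
      (isClosed_frontier.measurableSet.diff (hS.isClosed hK.finite).measurableSet) fun x hx => ?_
    have hxK : x ∈ K.space := hK.space_eq ▸ frontier_subset_closure hx.1
    obtain ⟨t, ht, hxt⟩ := mem_space_iff.1 hxK
    -- All nodes of the carrier of `x` lie outside the ball, so the interpolant vanishes on it.
    obtain ⟨s, hs, -, hxs⟩ := exists_isRelInterior ht hxt
    have h0 := hu.mem_Icc (a := 0) (b := 0) hs (fun q hq => by
      rw [tent_eq_zero hr fun hqb => (hdisj.closure_right Metric.isOpen_ball).le_bot
        ⟨hqb, hK.mem_closure_of_isRelInterior hO.toIsLipschitzDomain hS hs hxs hx hq⟩]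
      simp) hxs.mem_convexHull
    have : u x = 0 := by simpa using h0
    simp [hg, this]
  · have hint := hS.integrableOn_inner_outwardNormal hO.toIsLipschitzDomain hSO hK.finite
      (hgc.mono hSc)
    -- An edge either has a node in the ball, where the normal is controlled, or carries `u = 0`.
    -- Thus no part of the interface contributes negative flux.
    have hlow : ∀ᵐ x ∂arcLength.restrict S, c * u x ≤ ⟪g x, outwardNormal O x⟫ := by
      filter_upwards [hS.ae_isRelInterior hK.finite] with x hx
      obtain ⟨e, he, hxe⟩ := hx
      have hux := hIcc x (hSc (he.2.2 hxe.mem_convexHull))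
      rw [hg, inner_smul_left, RCLike.conj_to_real, mul_comm c]
      by_cases hq : ∃ q ∈ e, q ∈ Metric.ball p r
      · obtain ⟨q, hqe, hqb⟩ := hq
        exact mul_le_mul_of_nonneg_left (hnorm e he q hqe hqb x hxe) hux.1
      · push Not at hq
        have h0 := hu.mem_Icc (a := 0) (b := 0) he.1 (fun q hqe => by
          rw [tent_eq_zero hr (hq q hqe)]; simp) hxe.mem_convexHull
        have : u x = 0 := by simpa using h0
        simp [this]
    have hQp : 0 < ‖Q - p‖ := hl.trans_le hlQ
    set T := segment ℝ p (p + (m / ‖Q - p‖) • (Q - p)) with hT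
    have hTQ : T ⊆ segment ℝ p Q := by
      refine (convex_segment p Q).segment_subset (left_mem_segment ℝ _ _) ?_
      rw [segment_eq_image']
      exact ⟨_, ⟨by positivity, (div_le_one hQp).2 ((min_le_left _ _).trans hlQ)⟩, rfl⟩
    have hTS : T ⊆ S := hTQ.trans hpQ
    have hTm : MeasurableSet T := by
      rw [hT, ← convexHull_pair]
      exact ((toFinite _).isCompact_convexHull ℝ).measurableSet
    have hTlen : arcLength T = ENNReal.ofReal m := by
      rw [hT, hausdorffMeasure_segment, edist_dist, dist_self_add_right, norm_smul, norm_div,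
        norm_norm, div_mul_cancel₀ _ hQp.ne', Real.norm_of_nonneg hm0.le]
    have hhalf : ∀ y ∈ T, 1 / 2 ≤ u y := by
      intro y hy
      have h1 := hseg p y (((convex_segment p _).segment_subset (left_mem_segment ℝ _ _)
        hy).trans (hTS.trans hSc))
      obtain ⟨s, hs, hps⟩ := hp
      rw [hu.apply_node hs.1 hps, tent_self] at h1
      have h2 : ‖y - p‖ ≤ κ * r := by
        rw [hT, segment_eq_image'] at hy
        obtain ⟨t, ht, rfl⟩ := hy
        rw [add_sub_cancel_left, add_sub_cancel_left, norm_smul, norm_smul, norm_div, norm_norm,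
          div_mul_cancel₀ _ hQp.ne', Real.norm_of_nonneg hm0.le, Real.norm_of_nonneg ht.1]
        exact (mul_le_of_le_one_left hm0.le ht.2).trans (min_le_right _ _)
      have h3 : M * ‖y - p‖ ≤ 1 / 2 := by
        calc M * ‖y - p‖ ≤ M * (κ * r) := mul_le_mul_of_nonneg_left h2 hM0
          _ = 1 / 2 := by rw [hM]; field_simp
      linarith [(abs_le.1 h1).1]
    have hTfin : IsFiniteMeasure (arcLength.restrict T) := ⟨by simp [hTlen]⟩
    calc m * (c / 2) = ∫ x in T, c / 2 ∂arcLength := by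
          rw [setIntegral_const, Measure.real, hTlen, ENNReal.toReal_ofReal hm0.le, smul_eq_mul]
      _ ≤ ∫ x in T, ⟪g x, outwardNormal O x⟫ ∂arcLength := by
          refine integral_mono_ae (integrable_const _) (hint.mono_set hTS) ?_
          filter_upwards [ae_restrict_of_ae_restrict_of_subset hTS hlow, ae_restrict_mem hTm]
            with x h1 h2
          have := mul_le_mul_of_nonneg_left (hhalf x h2) hc.le
          linarith
      _ ≤ ∫ x in S, ⟪g x, outwardNormal O x⟫ ∂arcLength := by
          refine setIntegral_mono_set hint ?_ hTS.eventuallyLE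
          filter_upwards [hlow, ae_restrict_mem (hS.isClosed hK.finite).measurableSet] with x h1 h2
          exact (mul_nonneg hc.le (hIcc x (hSc h2)).1).trans h1
  · have h1 : ‖v‖ ^ 2 = (‖w‖ * ‖U‖) ^ 2 := by
      rw [PiLp.norm_sq_eq_of_L2, mul_pow, EuclideanSpace.norm_sq_eq, Finset.sum_mul]
      refine Finset.sum_congr rfl fun k _ => ?_
      rw [← mul_pow, ← norm_smul]
    have h2 : ‖v‖ = ‖w‖ * ‖U‖ := by
      rwa [sq_eq_sq₀ (norm_nonneg _) (by positivity)] at h1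
    rw [h2]
    have := mul_le_mul_of_nonneg_left hUn (norm_nonneg w)
    linarith

/-! ### Normals on mesh edges and corners of the interface -/

/-- The normal on an edge is determined by any boundary segment that shares an interior point with
the edge. -/
lemma outwardNormal_eq_of_mem_edgesOn {O S : Set Plane} (hO : IsLipschitzDomain O)
    (hSO : S ⊆ frontier O) {K : SimplicialComplex ℝ Plane} {a b : Plane} (hab : a ≠ b)
    (he : {a, b} ∈ edgesOn K S) {x y : Plane} (hx : x ∈ openSegment ℝ a b)
    (hy : y ∈ openSegment ℝ a b) : outwardNormal O x = outwardNormal O y := by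
  obtain ⟨n, -, -, hn⟩ := hO.exists_normal_segment hab
    ((openSegment_subset_of_mem_edgesOn he).trans hSO)
  rw [hn x hx, hn y hy]

lemma collinear_of_inner_eq_zero {P₀ P₁ P₂ n : Plane} (hn : ‖n‖ = 1) (h0 : ⟪P₁ - P₀, n⟫ = 0)
    (h2 : ⟪P₂ - P₁, n⟫ = 0) : Collinear ℝ {P₀, P₁, P₂} := by
  have hn1 : n 0 ^ 2 + n 1 ^ 2 = 1 := by
    have := EuclideanSpace.real_norm_sq_eq n
    rw [hn, Fin.sum_univ_two] at this
    linarith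
  have key : ∀ d : Plane, ⟪d, n⟫ = 0 →
      d = (d 1 * n 0 - d 0 * n 1) • (!₂[-n 1, n 0] : Plane) := by
    intro d hd
    rw [PiLp.inner_apply, Fin.sum_univ_two] at hd
    simp only [RCLike.inner_apply, conj_trivial] at hd
    ext i
    fin_cases i
    · simp
      linear_combination (-d 0) * hn1 + n 0 * hd
    · simp
      linear_combination (-d 1) * hn1 + n 1 * hd
  rw [collinear_iff_of_mem (p₀ := P₁) (by simp)]
  refine ⟨!₂[-n 1, n 0], ?_⟩
  rintro q (rfl | rfl | rfl)
  · exact ⟨_, by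
      rw [← key (q - P₁) (by rw [← neg_sub, inner_neg_left, h0, neg_zero])]; simp⟩
  · exact ⟨0, by simp⟩
  · exact ⟨_, by rw [← key _ h2]; simp⟩

/-- The corners of the interface are nodes of the partition. -/
lemma InducesPartition.isPartitionNode_of_corner {K : SimplicialComplex ℝ Plane}
    (hK : K.faces.Finite) {S : Set Plane} (hS : InducesPartition K S) {P₀ P₁ P₂ : Plane}
    (h : ¬ Collinear ℝ {P₀, P₁, P₂}) (h0 : segment ℝ P₁ P₀ ⊆ S) (h2 : segment ℝ P₁ P₂ ⊆ S) :
    IsPartitionNode K S P₁ := by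
  have hP1 := h0 (left_mem_segment ℝ _ _)
  rw [hS] at hP1
  obtain ⟨e, he, hPe⟩ := mem_iUnion₂.1 hP1
  obtain ⟨s, hs, hse, hPs⟩ := exists_isRelInterior he.1 hPe
  by_cases hc : s.card = 2
  · exfalso
    have hev : ∀ᶠ z in 𝓝 P₁, ∀ F ∈ edgesOn K S, z ∈ convexHull ℝ (F : Set Plane) →
        P₁ ∈ convexHull ℝ (F : Set Plane) := by
      refine (eventually_all_finite (finite_edgesOn hK S)).2 fun F _ => ?_
      by_cases hF : P₁ ∈ convexHull ℝ (F : Set Plane)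
      · exact Eventually.of_forall fun _ _ => hF
      · filter_upwards [(isClosed_convexHull_face F).isOpen_compl.mem_nhds hF] with z hz hz'
        exact absurd hz' hz
    -- If the corner were interior to a mesh edge, every interface edge nearby would contain that
    -- edge and so equal it; the interface would be straight there.
    have hev2 : ∀ᶠ z in 𝓝 P₁, z ∈ S → z ∈ convexHull ℝ (s : Set Plane) := by
      filter_upwards [hev] with z hz hzS
      rw [hS] at hzS
      obtain ⟨F, hF, hzF⟩ := mem_iUnion₂.1 hzS
      have hsF := subset_of_isRelInterior hs hF.1 hPs (hz F hF hzF)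
      rwa [Finset.eq_of_subset_of_card_le hsF (by rw [hc, hF.2.1])]
    obtain ⟨a, b, hab, rfl⟩ := Finset.card_eq_two.1 hc
    rw [Finset.coe_pair, convexHull_pair] at hev2
    have hPab := hPs.mem_openSegment hab
    have key : ∀ P : Plane, segment ℝ P₁ P ⊆ S → ∃ k : ℝ, P = k • (b - a) + P₁ := by
      intro P hP
      obtain ⟨t, ⟨ht1, ht2⟩⟩ := ((((tendsto_add_smul_nhds_zero P₁ (P - P₁)).eventually
        hev2).filter_mono (nhdsWithin_le_nhds (s := Ioi 0))).and
        (Ioo_mem_nhdsGT (zero_lt_one' ℝ))).exists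
      have hmem : P₁ + t • (P - P₁) ∈ segment ℝ a b := by
        refine ht1 (hP ?_)
        rw [segment_eq_image']
        exact ⟨t, Ioo_subset_Icc_self ht2, rfl⟩
      rw [segment_eq_image'] at hmem
      obtain ⟨k1, -, hk1⟩ := hmem
      rw [openSegment_eq_image'] at hPab
      obtain ⟨k2, -, hk2⟩ := hPab
      refine ⟨t⁻¹ * (k1 - k2), ?_⟩
      have e1 : t • (P - P₁) = (k1 - k2) • (b - a) := by
        have : t • (P - P₁) = (P₁ + t • (P - P₁)) - P₁ := by abel
        rw [this, ← hk1, ← hk2, sub_smul]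
        exact add_sub_add_left_eq_sub _ _ _
      rw [mul_smul, ← e1, smul_smul, inv_mul_cancel₀ ht2.1.ne', one_smul, sub_add_cancel]
    refine h ?_
    rw [collinear_iff_of_mem (p₀ := P₁) (by simp)]
    refine ⟨b - a, ?_⟩
    rintro q (rfl | rfl | rfl)
    · exact key _ h0
    · exact ⟨0, by simp⟩
    · exact key _ h2
  · have hle := Finset.card_le_card hse
    have hpos := (nonempty_of_mem_faces hs).card_pos
    have h1 : s.card = 1 := by have := he.2.1; omega
    obtain ⟨q, rfl⟩ := Finset.card_eq_one.1 h1
    have hq := hPs.mem_convexHull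
    rw [Finset.coe_singleton, convexHull_singleton, mem_singleton_iff] at hq
    exact ⟨e, he, hse (by simp [hq])⟩

/-! ### The discrete permeability condition -/

/-- The tent sits at the corner `P 1`, and `n₁ + n₂` has product `1 + ⟪n₁, n₂⟫` with both adjacent
normals. -/
lemma discretePermeability_of_polygon {O S : Set Plane} (hO : IsPolygonalLipschitzDomain O)
    (hSO : S ⊆ frontier O) {ι : Type*} {𝒯 : ι → SimplicialComplex ℝ Plane}
    (htri : ∀ h, IsTriangulation (𝒯 h) (closure O)) (hpart : ∀ h, InducesPartition (𝒯 h) S)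
    {κ : ℝ} (hκ : 0 < κ) (hreg : ∀ h, IsShapeRegular κ (𝒯 h)) {V : ι → Submodule ℝ (H1Vec O)}
    (hP1 : ∀ h, P1Cont (𝒯 h) O ⊆ V h) (hS : IsPolygonWithTwoOrMoreEdges S) :
    DiscretePermeability O S V := by
  have hL := hO.toIsLipschitzDomain
  obtain ⟨n, P, hn, hcol, hSP⟩ := hS
  have hc := hcol 0 hn
  rw [zero_add, zero_add] at hc
  have s01 : segment ℝ (P 0) (P 1) ⊆ S := by
    rw [hSP]; exact subset_biUnion_of_mem (u := fun i => segment ℝ (P i) (P (i + 1)))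
      (Finset.mem_coe.2 (Finset.mem_range.2 (by omega : 0 < n)))
  have s12 : segment ℝ (P 1) (P 2) ⊆ S := by
    rw [hSP]; exact subset_biUnion_of_mem (u := fun i => segment ℝ (P i) (P (i + 1)))
      (Finset.mem_coe.2 (Finset.mem_range.2 (by omega : 1 < n)))
  have h01 : P 0 ≠ P 1 := fun h => hc (by rw [h]; simpa using collinear_pair ℝ (P 1) (P 2))
  have h12 : P 1 ≠ P 2 := fun h => hc (by rw [h]; simpa using collinear_pair ℝ (P 0) (P 2))
  obtain ⟨n₁, hn₁, ho₁, hν₁⟩ := hL.exists_normal_segment h01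
    ((openSegment_subset_segment ℝ _ _).trans (s01.trans hSO))
  obtain ⟨n₂, hn₂, ho₂, hν₂⟩ := hL.exists_normal_segment h12
    ((openSegment_subset_segment ℝ _ _).trans (s12.trans hSO))
  -- Equality would give `n₁ = -n₂`, and both edges would be perpendicular to one vector.
  have hcpos : 0 < 1 + ⟪n₁, n₂⟫ := by
    have h1 : -1 ≤ ⟪n₁, n₂⟫ := by
      have := (abs_le.1 (abs_real_inner_le_norm n₁ n₂)).1
      simpa [hn₁, hn₂] using this
    refine lt_of_le_of_ne (by linarith) fun h => hc ?_
    have h3 : ⟪n₁, n₂⟫ = -1 := by linarith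
    have h2 : n₁ = -n₂ := (inner_eq_neg_one_iff_of_norm_eq_one hn₁ hn₂).1 h3
    refine collinear_of_inner_eq_zero hn₂ ?_ ho₂
    rw [h2, inner_neg_right, neg_eq_zero] at ho₁
    exact ho₁
  obtain ⟨r, hr, hball⟩ := Metric.eventually_nhds_iff_ball.1
    (hL.frontier_near_corner hc (s01.trans hSO) (s12.trans hSO))
  obtain ⟨β₀, β₁, hβ₀, hβ₁, H⟩ := exists_P1Cont_flux hO hSO hκ hr hcpos
    (norm_pos_iff.2 (sub_ne_zero.2 h01)) (n₁ + n₂)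
  refine ⟨β₀, β₁, hβ₀, hβ₁, fun h => ?_⟩
  have s10 : segment ℝ (P 1) (P 0) ⊆ S := by rwa [segment_symm]
  have hdisj : Disjoint (Metric.ball (P 1) r) (frontier O \ S) := by
    refine disjoint_left.2 fun x hx hxf => hxf.2 ?_
    exact (hball x hx hxf.1).elim (fun h => s01 h) fun h => s12 h
  have hnormal : ∀ e ∈ edgesOn (𝒯 h) S, ∀ q ∈ e, q ∈ Metric.ball (P 1) r → ∀ x,
      IsRelInterior e x → 1 + ⟪n₁, n₂⟫ ≤ ⟪n₁ + n₂, outwardNormal O x⟫ := by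
    intro e he q hq hqb x hx
    obtain ⟨b, hqb', rfl⟩ := Finset.exists_eq_pair_of_mem he.2.1 hq
    -- The edge may leave the ball, but its normal is constant and can be read at a point near the
    -- node `q`, which lies on one of the two sides of the corner.
    obtain ⟨y, hy, hyb, hyN⟩ := exists_mem_openSegment_of_mem_nhds hqb'
      (Metric.isOpen_ball.mem_nhds hqb) (toFinite {P 0, P 1, P 2})
    simp only [mem_insert_iff, mem_singleton_iff, not_or] at hyN
    rw [outwardNormal_eq_of_mem_edgesOn hL hSO hqb' he (hx.mem_openSegment hqb') hy]
    rcases hball y hyb (hSO (openSegment_subset_of_mem_edgesOn he hy)) with hy' | hy'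
    · rw [hν₁ y (mem_openSegment_of_ne_left_right (Ne.symm hyN.1) (Ne.symm hyN.2.1) hy'),
        inner_add_left, real_inner_self_eq_norm_sq, hn₁, real_inner_comm]
      norm_num
    · rw [hν₂ y (mem_openSegment_of_ne_left_right (Ne.symm hyN.2.1) (Ne.symm hyN.2.2) hy'),
        inner_add_left, real_inner_self_eq_norm_sq, hn₂]
      linarith
  obtain ⟨v, hv, hv'⟩ := H (𝒯 h) (htri h) (hpart h) (hreg h) (P 1) (P 0)
    ((hpart h).isPartitionNode_of_corner (htri h).finite hc s10 s12) s10 le_rfl hdisj hnormal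
  exact ⟨v, hP1 h hv, hv'⟩

lemma discretePermeability_of_segment {O S : Set Plane} (hO : IsPolygonalLipschitzDomain O)
    (hSO : S ⊆ frontier O) {ι : Type*} {𝒯 : ι → SimplicialComplex ℝ Plane}
    (htri : ∀ h, IsTriangulation (𝒯 h) (closure O)) (hpart : ∀ h, InducesPartition (𝒯 h) S)
    {κ : ℝ} (hκ : 0 < κ) (hreg : ∀ h, IsShapeRegular κ (𝒯 h)) {V : ι → Submodule ℝ (H1Vec O)}
    (hP1 : ∀ h, P1Cont (𝒯 h) O ⊆ V h) (hS : IsLineSegment S) {δ : ℝ} (hδ : 0 < δ)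
    (hnode : ∀ h, ∃ p, IsPartitionNode (𝒯 h) S p ∧
      Disjoint (Metric.ball p δ) (frontier O \ S)) :
    DiscretePermeability O S V := by
  have hL := hO.toIsLipschitzDomain
  obtain ⟨A, B, hAB, hSAB⟩ := hS
  obtain ⟨n, hn, -, hν⟩ := hL.exists_normal_segment hAB
    ((openSegment_subset_segment ℝ _ _).trans (hSAB ▸ hSO))
  have hl : 0 < ‖A - B‖ / 2 := half_pos (norm_pos_iff.2 (sub_ne_zero.2 hAB))
  obtain ⟨β₀, β₁, hβ₀, hβ₁, H⟩ := exists_P1Cont_flux hO hSO hκ hδ zero_lt_one hl n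
  refine ⟨β₀, β₁, hβ₀, hβ₁, fun h => ?_⟩
  obtain ⟨p, hp, hdisj⟩ := hnode h
  have hpS : p ∈ S := by
    obtain ⟨s, hs, hps⟩ := hp
    exact hs.2.2 (subset_convexHull ℝ _ hps)
  have hconv : Convex ℝ S := hSAB ▸ convex_segment A B
  -- Wherever the node lies, one endpoint is at least half the length of the segment away; this
  -- gives a length `l` independent of `h`.
  have hQ : ∃ Q ∈ S, ‖A - B‖ / 2 ≤ ‖Q - p‖ := by
    by_contra! hno
    have h1 := hno A (hSAB ▸ left_mem_segment ℝ A B)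
    have h2 := hno B (hSAB ▸ right_mem_segment ℝ A B)
    have h3 := norm_sub_le_norm_sub_add_norm_sub A p B
    rw [norm_sub_rev p B] at h3
    linarith
  obtain ⟨Q, hQS, hQ⟩ := hQ
  have hnormal : ∀ e ∈ edgesOn (𝒯 h) S, ∀ q ∈ e, q ∈ Metric.ball p δ → ∀ x,
      IsRelInterior e x → 1 ≤ ⟪n, outwardNormal O x⟫ := by
    intro e he q hq _ x hx
    obtain ⟨b, hqb, rfl⟩ := Finset.exists_eq_pair_of_mem he.2.1 hq
    obtain ⟨y, hy, -, hyN⟩ := exists_mem_openSegment_of_mem_nhds hqb univ_mem (toFinite {A, B})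
    simp only [mem_insert_iff, mem_singleton_iff, not_or] at hyN
    have hyS := openSegment_subset_of_mem_edgesOn he hy
    rw [hSAB] at hyS
    rw [outwardNormal_eq_of_mem_edgesOn hL hSO hqb he (hx.mem_openSegment hqb) hy,
      hν y (mem_openSegment_of_ne_left_right (Ne.symm hyN.1) (Ne.symm hyN.2) hyS),
      real_inner_self_eq_norm_sq, hn]
    norm_num
  obtain ⟨v, hv, hv'⟩ := H (𝒯 h) (htri h) (hpart h) (hreg h) p Q hp
    (hconv.segment_subset hpS hQS) hQ hdisj hnormal
  exact ⟨v, hP1 h hv, hv'⟩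

/-- The part of the Stokes boundary outside of the interface lies on the outer boundary. -/
lemma IsStokesDarcyLayout.frontier_diff_subset {Ω ΩS ΩD : Set Plane}
    (hgeo : IsStokesDarcyLayout Ω ΩS ΩD) : frontier ΩS \ interface ΩS ΩD ⊆ frontier Ω := by
  rintro x ⟨hx, hxI⟩
  have hxc := closure_mono hgeo.stokes_subset (frontier_subset_closure hx)
  rw [hgeo.domain.isOpen.frontier_eq]
  refine ⟨hxc, fun hxΩ => ?_⟩
  rcases hgeo.cover hxΩ with (h | h) | h
  · rw [hgeo.stokes.isOpen.frontier_eq] at hx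
    exact hx.2 h
  -- The open Darcy domain is disjoint from the Stokes domain, hence also from its closure.
  · exact (hgeo.disjoint.closure_left hgeo.darcy.isOpen).le_bot ⟨frontier_subset_closure hx, h⟩
  · exact hxI h

theorem mainTheorem8 {Ω ΩS ΩD : Set Plane} (hgeo : IsStokesDarcyLayout Ω ΩS ΩD)
    {ι : Type*} (𝒯 : ι → Geometry.SimplicialComplex ℝ Plane)
    (htri : ∀ h, IsTriangulation (𝒯 h) (closure ΩS))
    (hpart : ∀ h, InducesPartition (𝒯 h) (interface ΩS ΩD))
    (hreg : ∃ κ : ℝ, 0 < κ ∧ ∀ h, IsShapeRegular κ (𝒯 h))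
    (V : ι → Submodule ℝ (H1Vec ΩS))
    (hP1 : ∀ h, P1Cont (𝒯 h) ΩS ⊆ V h)
    (hS : IsPolygonWithTwoOrMoreEdges (interface ΩS ΩD) ∨
      (IsLineSegment (interface ΩS ΩD) ∧ ∃ δ : ℝ, 0 < δ ∧
        ∀ h, ∃ p, IsPartitionNode (𝒯 h) (interface ΩS ΩD) p ∧
          δ ≤ Metric.infDist p (frontier Ω))) :
    DiscretePermeability ΩS (interface ΩS ΩD) V := by
  obtain ⟨κ, hκ, hreg⟩ := hreg
  have hSO : interface ΩS ΩD ⊆ frontier ΩS := inter_subset_left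
  rcases hS with hS | ⟨hS, δ, hδ, hnode⟩
  · exact discretePermeability_of_polygon hgeo.stokes hSO htri hpart hκ hreg hP1 hS
  · refine discretePermeability_of_segment hgeo.stokes hSO htri hpart hκ hreg hP1 hS hδ fun h => ?_
    obtain ⟨p, hp, hpδ⟩ := hnode h
    refine ⟨p, hp, disjoint_left.2 fun x hx hxf => ?_⟩
    have h1 := Metric.infDist_le_dist_of_mem (x := p) (hgeo.frontier_diff_subset hxf)
    rw [Metric.mem_ball, dist_comm] at hx
    linarith

end
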